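/- Let $V$ be a countably infinite set. A frog configuration $(n,s)$ on $V$ consists of numbers $n(x)\in\{0,1,2,\dots\}$, $x\in V$ (the number of sleeping frogs at $x$), and of paths $(s_j(x,i))_{j\ge 0}$ in $V$, $x\in V$, $i\ge 1$, with $s_0(x,i)=x$ (the position of the $i$-th frog originating at $x$ after $j$ steps, once it has been woken up). For $v\in V$ set $W^v_0:=\{v\}$ and, recursively for $j\ge 1$, $$W^v_j:=\Big\{x\in V\setminus\bigcup_{k=0}^{j-1}W^v_k \;\Big|\; \exists\, k<j,\ y\in W^v_k,\ 1\le i\le n(y):\ s_{j-k}(y,i)=x\Big\},\qquad W^v:=\bigcup_{j\ge 0}W^v_j .$$ The site $v$ is called recurrent for $(n,s)$ if there are infinitely many distinct $x\in W^v$ for which there are $i\in\{1,\dots,n(x)\}$ and $j\ge 0$ with $s_j(x,i)=v$; otherwise $v$ is called transient. A stochastic matrix $K$ on $V$ is called transitive if for all $x,y\in V$ there is a permutation $\varphi$ of $V$ with $\varphi(x)=y$ and $K(\varphi(u),\varphi(v))=K(u,v)$ for all $u,v\in V$. **Theorem (Transitive Markov chains).** Let the frog trajectories $(S_j(x,i))_{j\ge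 0}$, $x\in V$, $i\ge 1$, be Markov chains with $S_0(x,i)=x$ and with a common transitive and irreducible transition matrix on $V$. Let the numbers $\eta(x)\in\{0,1,2,\dots\}$, $x\in V$, of sleeping frogs be identically distributed, and assume that the quantities $\eta(x)$, $(S_j(x,i))_{j\ge 0}$, $x\in V$, $i\ge 1$, are independent. Then either with probability $1$ every $x\in V$ is transient for $(\eta,S)$, or with probability $1$ every $x\in V$ with $\eta(x)\ge 1$ is recurrent for $(\eta,S)$. -/

import Mathlib

namespace FrogModel

open MeasureTheory ProbabilityTheory

/-- `K` is a stochastic matrix on `V`: its entries are nonnegative and every row sums to `1`. -/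
structure IsStochastic {V : Type*} (K : V → V → ℝ) : Prop where
  nonneg : ∀ x y, 0 ≤ K x y
  row_sum : ∀ x, HasSum (K x) 1

/-- `K` is transitive: for all `x`, `y` some permutation of `V` maps `x` to `y` and
leaves `K` invariant. -/
def IsTransitive {V : Type*} (K : V → V → ℝ) : Prop :=
  ∀ x y, ∃ φ : Equiv.Perm V, φ x = y ∧ ∀ u v, K (φ u) (φ v) = K u v

/-- `K` is irreducible: any `y` can be reached from any `x` along finitely many steps of
positive transition probability. -/
def IsIrreducible {V : Type*} (K : V → V → ℝ) : Prop :=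
  ∀ x y, Relation.ReflTransGen (fun a b => 0 < K a b) x y

/-- `Y` is a (time-homogeneous) Markov chain under `P` which starts almost surely at `x` and has
transition matrix `K`: given `Y 0 = s 0, …, Y m = s m`, whenever this has positive probability,
the conditional probability of `Y (m + 1) = y` is `K (s m) y`. -/
structure IsMarkovChain {Ω V : Type*} [MeasurableSpace Ω] [MeasurableSpace V] (P : Measure Ω)
    (K : V → V → ℝ) (x : V) (Y : ℕ → Ω → V) : Prop where
  measurable : ∀ j, Measurable (Y j)
  start : ∀ᵐ ω ∂P, Y 0 ω = x
  step : ∀ (m : ℕ) (s : ℕ → V) (y : V), P {ω | ∀ k ≤ m, Y k ω = s k} ≠ 0 →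
    (cond P {ω | ∀ k ≤ m, Y k ω = s k}).real {ω | Y (m + 1) ω = y} = K (s m) y

/-- Here and below `n x` is the number of frogs at `x`, the frogs at `x` are numbered
`i = 0, …, n x - 1`, and `s x i j` is the position after `j` steps of frog number `i`
originating at `x`.

`firstVisited n s v j` is the set of sites which are visited for the first time at time `j`
when the site `v` is activated at time `0`; a frog originating at `y` starts moving at the time
`k` at which `y` is first visited, so that it is at `s y i (j - k)` at time `j`. -/
def firstVisited {V : Type*} (n : V → ℕ) (s : V → ℕ → ℕ → V) (v : V) : ℕ → Set V
  | 0 => {v}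
  | j + 1 => {x | (∀ k, ∀ _ : k < j + 1, x ∉ firstVisited n s v k) ∧
      ∃ k, ∃ _ : k < j + 1, ∃ y ∈ firstVisited n s v k, ∃ i < n y, s y i (j + 1 - k) = x}

/-- The set of sites which are ever visited when `v` is activated at time `0`. -/
def visited {V : Type*} (n : V → ℕ) (s : V → ℕ → ℕ → V) (v : V) : Set V :=
  ⋃ j, firstVisited n s v j

/-- `v` is recurrent: when `v` is activated at time `0`, then `v` is visited by active frogs
originating at infinitely many distinct sites. -/
def IsRecurrent {V : Type*} (n : V → ℕ) (s : V → ℕ → ℕ → V) (v : V) : Prop :=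
  {x | x ∈ visited n s v ∧ ∃ i < n x, ∃ j, s x i j = v}.Infinite

/-- A site which is not recurrent is transient. -/
def IsTransient {V : Type*} (n : V → ℕ) (s : V → ℕ → ℕ → V) (v : V) : Prop :=
  ¬ IsRecurrent n s v

/-- The frog numbers `η x`, `x ∈ V`, and the frog trajectories `(S x i j)_j`, `x ∈ V`, `i ∈ ℕ`,
all together form an independent family under `P`. -/
def IndependentIngredients {Ω V : Type*} [MeasurableSpace Ω] [MeasurableSpace V] (P : Measure Ω)
    (η : V → Ω → ℕ) (S : V → ℕ → ℕ → Ω → V) : Prop :=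
  iIndep (Sum.elim
    (fun x : V => MeasurableSpace.comap (η x) inferInstance)
    (fun p : V × ℕ => MeasurableSpace.comap (fun ω (j : ℕ) => S p.1 p.2 j ω) inferInstance)) P

end FrogModel

/-! The event that some site is recurrent is invariant under the symmetries of `K`. By B. H.
Neumann's lemma a symmetry can move any finite set of sites off itself, so this event is
approximately independent of itself and has probability `0` or `1`
(`measure_eq_zero_or_one_of_invariant`). Probability `0` is the first alternative; suppose it is
`1`.

Almost surely infinitely many visitors at one site force infinitely many at every site
(`ae_spreading`): by irreducibility each further arrival at `u` goes on to visit `w` with a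
conditional probability bounded below. Hence a site that activates a recurrent site is recurrent,
and changing the number of frogs at a transient site destroys no other recurrence.

Let `missProb` be the probability that an independent chain from `x` misses all recurrent sites. It
is subharmonic in `x`, and its law does not depend on `x`. Equality in Jensen's inequality for the
square therefore makes it constant along transitions (`ae_missProb_eq`). It vanishes at a recurrent
site, hence everywhere.

Finally, let `v` be transient with `k + 1` frogs and resample the path of the last one. The
recurrent sites did not need that frog, and the new path almost surely hits one of them, so `v`
becomes recurrent. Resampling preserves the law, so such a `v` occurs with probability `0`
(`measure_transient_eq_zero`). -/

namespace FrogModel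

open MeasureTheory ProbabilityTheory

/-! ### Activation, recurrence and stopped paths for a fixed configuration -/

section Deterministic

variable {V : Type*}

/-- Some frog originating at `x` visits `y` at a positive time of its life. -/
def Wakes (n : V → ℕ) (s : V → ℕ → ℕ → V) (x y : V) : Prop := ∃ i < n x, ∃ j, s x i (j + 1) = y

/-- Some frog originating at `x` ever visits `y`. -/
def Hits (n : V → ℕ) (s : V → ℕ → ℕ → V) (x y : V) : Prop := ∃ i < n x, ∃ j, s x i j = y

/-- Activating `x` eventually activates `y`. -/
def Reaches (n : V → ℕ) (s : V → ℕ → ℕ → V) : V → V → Prop := Relation.ReflTransGen (Wakes n s)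

/-- The sites activated from `o` some frog of which visits `u`. -/
def visitors (n : V → ℕ) (s : V → ℕ → ℕ → V) (o u : V) : Set V :=
  {x | Reaches n s o x ∧ Hits n s x u}

/-- If infinitely many activated sites send a frog to one site, then so they do to every site. -/
def Spreading (n : V → ℕ) (s : V → ℕ → ℕ → V) : Prop :=
  ∀ o u w, (visitors n s o u).Infinite → (visitors n s o w).Infinite

variable {n n' : V → ℕ} {s s' : V → ℕ → ℕ → V} {o u v w x y z : V}

/-- Waking times do not matter: if `y` is first visited at time `k` and one of its frogs is at `x`
after `j + 1` steps, then `x` is first visited at time `k + j + 1` or earlier. -/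
theorem mem_visited_iff : x ∈ visited n s v ↔ Reaches n s v x := by
  constructor
  · intro h
    obtain ⟨j, hj⟩ := Set.mem_iUnion.1 h
    clear h
    induction j using Nat.strong_induction_on generalizing x with
    | _ j ih =>
      cases j with
      | zero =>
        rw [firstVisited] at hj
        rw [Set.mem_singleton_iff.1 hj]
        exact Relation.ReflTransGen.refl
      | succ j =>
        rw [firstVisited] at hj
        obtain ⟨-, k, hk, y, hy, i, hi, hs⟩ := hj
        refine (ih k hk hy).tail ⟨i, hi, j - k, ?_⟩
        rwa [show j - k + 1 = j + 1 - k by omega]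
  · intro h
    induction h with
    | refl => exact Set.mem_iUnion.2 ⟨0, by rw [firstVisited]; rfl⟩
    | @tail y x _ hyx ih =>
      obtain ⟨k, hk⟩ := Set.mem_iUnion.1 ih
      obtain ⟨i, hi, j, hj⟩ := hyx
      by_cases hx : ∃ l, l < k + j + 1 ∧ x ∈ firstVisited n s v l
      · obtain ⟨l, -, hl⟩ := hx
        exact Set.mem_iUnion.2 ⟨l, hl⟩
      · push Not at hx
        refine Set.mem_iUnion.2 ⟨k + j + 1, ?_⟩
        rw [firstVisited]
        refine ⟨hx, k, by omega, y, hk, i, hi, ?_⟩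
        rwa [show k + j + 1 - k = j + 1 by omega]

theorem isRecurrent_iff : IsRecurrent n s v ↔ (visitors n s v v).Infinite := by
  have : {x | x ∈ visited n s v ∧ ∃ i < n x, ∃ j, s x i j = v} = visitors n s v v := by
    ext x
    exact and_congr_left fun _ => mem_visited_iff
  rw [IsRecurrent, this]

theorem Wakes.mono (hn : ∀ x, n x ≤ n' x) (hs : ∀ x, ∀ i < n x, s x i = s' x i)
    (h : Wakes n s x y) : Wakes n' s' x y := by
  obtain ⟨i, hi, j, hj⟩ := h
  exact ⟨i, hi.trans_le (hn x), j, by rw [← hs x i hi, hj]⟩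

theorem Hits.mono (hn : ∀ x, n x ≤ n' x) (hs : ∀ x, ∀ i < n x, s x i = s' x i)
    (h : Hits n s x y) : Hits n' s' x y := by
  obtain ⟨i, hi, j, hj⟩ := h
  exact ⟨i, hi.trans_le (hn x), j, by rw [← hs x i hi, hj]⟩

theorem visitors_mono (hn : ∀ x, n x ≤ n' x) (hs : ∀ x, ∀ i < n x, s x i = s' x i) :
    visitors n s o u ⊆ visitors n' s' o u :=
  fun _ hx => ⟨Relation.ReflTransGen.mono (fun _ _ h => Wakes.mono hn hs h) _ _ hx.1, hx.2.mono hn hs⟩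

/-- A transient site is not needed for the recurrence of any other site. -/
theorem IsRecurrent.of_eq_off (hgood : Spreading n s) (hv : ¬ IsRecurrent n s v)
    (hn : ∀ x, x ≠ v → n' x = n x) (hz : IsRecurrent n s z) : IsRecurrent n' s z := by
  rw [isRecurrent_iff] at hz hv ⊢
  intro hfin
  -- An activation path either never uses the frogs of `v`, and so survives the change, or passes
  -- through `v`. The sites of the second kind contribute finitely many visitors, since otherwise
  -- spreading would make `v` recurrent.
  have hreach : ∀ x, Reaches n s z x → Reaches n' s z x ∨ Reaches n s v x := by
    intro x hx
    induction hx with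
    | refl => exact Or.inl Relation.ReflTransGen.refl
    | @tail y x _ hyx ih =>
      rcases ih with ih | ih
      · by_cases hyv : y = v
        · subst hyv
          exact Or.inr (Relation.ReflTransGen.single hyx)
        · refine Or.inl (ih.tail ?_)
          obtain ⟨i, hi, j⟩ := hyx
          exact ⟨i, by rwa [hn y hyv], j⟩
      · exact Or.inr (ih.tail hyx)
  have hsub : visitors n s z z ⊆ (visitors n' s z z ∪ {v}) ∪ visitors n s v z := by
    rintro x ⟨hx, hxz⟩
    rcases hreach x hx with h | h
    · by_cases hxv : x = v
      · exact Or.inl (Or.inr hxv)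
      · obtain ⟨i, hi, j⟩ := hxz
        exact Or.inl (Or.inl ⟨h, i, by rwa [hn x hxv], j⟩)
    · exact Or.inr ⟨h, hxz⟩
  have h2 : (visitors n s v z).Infinite := fun h =>
    hz (((hfin.union (Set.finite_singleton v)).union h).subset hsub)
  exact hv (hgood v z v h2)

theorem IsRecurrent.of_reaches (hgood : Spreading n s) (hvz : Reaches n s v z)
    (hz : IsRecurrent n s z) : IsRecurrent n s v := by
  rw [isRecurrent_iff] at hz ⊢
  exact hgood v z v (hz.mono fun x hx => ⟨hvz.trans hx.1, hx.2⟩)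

theorem IsRecurrent.mono (hn : ∀ x, n x ≤ n' x) (hs : ∀ x, ∀ i < n x, s x i = s' x i)
    (hz : IsRecurrent n s z) : IsRecurrent n' s' z := by
  rw [isRecurrent_iff] at hz ⊢
  exact Set.Infinite.mono (visitors_mono hn hs) hz

/-- Transport of a configuration along a permutation of the sites. -/
theorem reaches_perm (φ : Equiv.Perm V) (hn : ∀ x, n' (φ x) = n x)
    (hs : ∀ x i j, s' (φ x) i j = φ (s x i j)) (h : Reaches n s v x) :
    Reaches n' s' (φ v) (φ x) := by
  refine Relation.ReflTransGen.lift φ ?_ _ _ h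
  rintro a b ⟨i, hi, j, hj⟩
  exact ⟨i, by rwa [hn], j, by rw [hs, hj]⟩

theorem IsRecurrent.perm (φ : Equiv.Perm V) (hn : ∀ x, n' (φ x) = n x)
    (hs : ∀ x i j, s' (φ x) i j = φ (s x i j)) (h : IsRecurrent n s v) :
    IsRecurrent n' s' (φ v) := by
  rw [isRecurrent_iff] at h ⊢
  refine (h.image φ.injective.injOn).mono ?_
  rintro _ ⟨x, ⟨hx, i, hi, j, hj⟩, rfl⟩
  exact ⟨reaches_perm φ hn hs hx, i, by rwa [hn], j, by rw [hs, hj]⟩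

/-- The path `t` stopped when it first visits `u`. -/
noncomputable def stopAt (u : V) (t : ℕ → V) (k : ℕ) : V :=
  open Classical in if ∃ m ≤ k, t m = u then u else t k

theorem stopAt_eq_self {t : ℕ → V} (h : ∀ k, t k ≠ u) : stopAt u t = t := by
  funext k
  rw [stopAt, if_neg]
  rintro ⟨m, -, hm⟩
  exact h m hm

theorem stopAt_apply_eq_iff {t : ℕ → V} {k : ℕ} : stopAt u t k = u ↔ ∃ m ≤ k, t m = u := by
  rw [stopAt]
  split_ifs with h
  · simpa using h
  · refine iff_of_false (fun hk => h ⟨k, le_rfl, hk⟩) h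

theorem stopAt_apply_of_forall_lt {t : ℕ → V} {k : ℕ} (h : ∀ m < k, t m ≠ u) : stopAt u t k = t k := by
  rw [stopAt]
  split_ifs with h'
  · obtain ⟨m, hm, rfl⟩ := h'
    rcases hm.lt_or_eq with hm | rfl
    · exact absurd rfl (h m hm)
    · rfl
  · rfl

theorem exists_eq_of_stopAt_eq {t t' : ℕ → V} (h : stopAt u t = stopAt u t') (ht : ∃ k, t k = u) :
    ∃ k, t' k = u := by
  obtain ⟨k, hk⟩ := ht
  have : stopAt u t k = u := stopAt_apply_eq_iff.2 ⟨k, le_rfl, hk⟩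
  rw [h, stopAt_apply_eq_iff] at this
  obtain ⟨m, -, hm⟩ := this
  exact ⟨m, hm⟩

/-- All frogs outside `F` are stopped at their first visit to `u`. -/
noncomputable def stopOutside (u : V) (F : Finset (V × ℕ)) (s : V → ℕ → ℕ → V) (x : V) (i : ℕ) :
    ℕ → V :=
  open Classical in if (x, i) ∈ F then s x i else stopAt u (s x i)

/-- The frogs outside `F` which visit `u` and are activated from `o` while the frogs outside `F` are
stopped at `u`. -/
def arrivals (n : V → ℕ) (s : V → ℕ → ℕ → V) (o u : V) (F : Finset (V × ℕ)) : Set (V × ℕ) :=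
  {p | p ∉ F ∧ p.2 < n p.1 ∧ Reaches n (stopOutside u F s) o p.1 ∧ ∃ k, s p.1 p.2 k = u}

theorem Reaches.of_stopOutside {F : Finset (V × ℕ)} (hs : ∀ x i, s x i 0 = x)
    (h : Reaches n (stopOutside u F s) o x) : Reaches n s o x := by
  induction h with
  | refl => exact Relation.ReflTransGen.refl
  | @tail y x _ hyx ih =>
    obtain ⟨i, hi, j, hj⟩ := hyx
    have key : ∃ j, s y i j = x := by
      rw [stopOutside] at hj
      split_ifs at hj
      · exact ⟨_, hj⟩
      · rw [stopAt] at hj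
        split_ifs at hj with h
        · obtain ⟨m, -, hm⟩ := h
          exact ⟨m, hm.trans hj⟩
        · exact ⟨_, hj⟩
    obtain ⟨j, hj⟩ := key
    -- A path stopped at time `0` stays at its origin, so it activates nothing new.
    cases j with
    | zero =>
      rw [hs] at hj
      rwa [← hj]
    | succ j => exact ih.tail ⟨i, hi, j, hj⟩

/-- Without arrivals no activated frog outside `F` ever meets `u`, so stopping changes nothing and
every visitor is the origin of a frog in `F`. -/
theorem visitors_finite_of_arrivals_eq_empty {F : Finset (V × ℕ)}
    (h : arrivals n s o u F = ∅) : (visitors n s o u).Finite := by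
  have hno : ∀ x i, (x, i) ∉ F → i < n x → Reaches n (stopOutside u F s) o x →
      ∀ k, s x i k ≠ u := by
    intro x i hF hi hx k hk
    have : (x, i) ∈ arrivals n s o u F := ⟨hF, hi, hx, k, hk⟩
    rw [h] at this
    exact this
  have hreach : ∀ x, Reaches n s o x → Reaches n (stopOutside u F s) o x := by
    intro x hx
    induction hx with
    | refl => exact Relation.ReflTransGen.refl
    | @tail y x _ hyx ih =>
      obtain ⟨i, hi, j, hj⟩ := hyx
      refine ih.tail ⟨i, hi, j, ?_⟩
      rw [stopOutside]
      split_ifs with hF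
      · exact hj
      · rw [stopAt_eq_self (hno y i hF hi ih), hj]
  refine (F.finite_toSet.image Prod.fst).subset ?_
  rintro x ⟨hx, i, hi, k, hk⟩
  by_contra hxF
  refine hno x i (fun hF => hxF ⟨_, hF, rfl⟩) hi (hreach x hx) k hk

/-- If infinitely many activated sites send a frog to `u` but only finitely many send one to `w`,
then from some finite set of frogs on there are always further arrivals at `u`, none of which
visits `w`. -/
theorem exists_forall_arrivals (hs : ∀ x i, s x i 0 = x) (hu : (visitors n s o u).Infinite)
    (hw : (visitors n s o w).Finite) : ∃ F : Finset (V × ℕ), ∀ F', F ⊆ F' →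
      (arrivals n s o u F').Nonempty ∧ ∀ p ∈ arrivals n s o u F', ∀ k, s p.1 p.2 k ≠ w := by
  classical
  -- All frogs of the finitely many sites that send a frog to `w`; an arrival that visits `w` would
  -- be one of them.
  refine ⟨hw.toFinset.biUnion fun x => (Finset.range (n x)).image (Prod.mk x), fun F' hF' => ?_⟩
  refine ⟨?_, fun p hp k hk => hp.1 (hF' ?_)⟩
  · rw [Set.nonempty_iff_ne_empty]
    exact fun h => hu (visitors_finite_of_arrivals_eq_empty h)
  · simp only [Finset.mem_biUnion, Set.Finite.mem_toFinset, Finset.mem_image, Finset.mem_range]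
    exact ⟨p.1, ⟨Reaches.of_stopOutside hs hp.2.2.1, p.2, hp.2.1, k, hk⟩, p.2, hp.2.1, rfl⟩

end Deterministic

/-! ### Measurability of activation, recurrence and arrivals -/

section Measurability

variable {V α : Type*} [MeasurableSpace α] [MeasurableSpace V] [Countable V]
  [DiscreteMeasurableSpace V] {n : α → V → ℕ} {s : α → V → ℕ → ℕ → V}

theorem measurableSet_exists_lt_and (hn : ∀ x, Measurable fun a => n a x)
    (hs : ∀ x i j, Measurable fun a => s a x i j) (x y : V) (d : ℕ) :
    MeasurableSet {a | ∃ i < n a x, ∃ j, s a x i (j + d) = y} := by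
  have : {a | ∃ i < n a x, ∃ j, s a x i (j + d) = y} =
      ⋃ i, ({a | i < n a x} ∩ ⋃ j, {a | s a x i (j + d) = y}) := by
    ext a
    simp
  rw [this]
  refine MeasurableSet.iUnion fun i => (measurableSet_lt measurable_const (hn x)).inter
    (MeasurableSet.iUnion fun j => ?_)
  exact hs x i (j + d) (measurableSet_singleton y)

/-- Activation in `k` links is defined by recursion on `k` with an existential over the countable
set `V`, and activation is the union over `k`. -/
theorem measurableSet_reaches (hn : ∀ x, Measurable fun a => n a x)
    (hs : ∀ x i j, Measurable fun a => s a x i j) (o x : V) :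
    MeasurableSet {a | Reaches (n a) (s a) o x} := by
  have key : ∀ a, Reaches (n a) (s a) o x ↔
      ∃ k, (Nat.rec (fun y => o = y) (fun _ r y => ∃ z, r z ∧ Wakes (n a) (s a) z y) k : V → Prop)
        x := by
    intro a
    constructor
    · intro h
      induction h with
      | refl => exact ⟨0, rfl⟩
      | tail _ h ih =>
        obtain ⟨k, hk⟩ := ih
        exact ⟨k + 1, _, hk, h⟩
    · rintro ⟨k, hk⟩
      induction k generalizing x with
      | zero =>
        obtain rfl : o = x := hk
        exact Relation.ReflTransGen.refl
      | succ k ih =>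
        obtain ⟨z, hz, h⟩ := hk
        exact (ih z hz).tail h
  have hset : {a | Reaches (n a) (s a) o x} = ⋃ k, {a | (Nat.rec (fun y => o = y)
      (fun _ r y => ∃ z, r z ∧ Wakes (n a) (s a) z y) k : V → Prop) x} := by
    ext a
    simp only [Set.mem_iUnion]
    exact key a
  rw [hset]
  refine MeasurableSet.iUnion fun k => ?_
  clear key hset
  induction k generalizing x with
  | zero => exact MeasurableSet.const (o = x)
  | succ k ih =>
    have hset : {a | ∃ z, (Nat.rec (fun y => o = y)
        (fun _ r y => ∃ z, r z ∧ Wakes (n a) (s a) z y) k : V → Prop) z ∧ Wakes (n a) (s a) z x} =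
        ⋃ z, ({a | (Nat.rec (fun y => o = y)
        (fun _ r y => ∃ z, r z ∧ Wakes (n a) (s a) z y) k : V → Prop) z} ∩
          {a | ∃ i < n a z, ∃ j, s a z i (j + 1) = x}) := by
      ext a
      simp only [Set.mem_iUnion]
      rfl
    refine (congrArg MeasurableSet hset).mpr ?_
    exact MeasurableSet.iUnion fun z => (ih z).inter (measurableSet_exists_lt_and hn hs z x 1)

theorem measurableSet_isRecurrent (hn : ∀ x, Measurable fun a => n a x)
    (hs : ∀ x i j, Measurable fun a => s a x i j) (v : V) :
    MeasurableSet {a | IsRecurrent (n a) (s a) v} := by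
  have : {a | IsRecurrent (n a) (s a) v} =
      -- A set is infinite when no finite set contains it, and there are only countably many finite
      -- sets to test.
      ⋂ F : Finset V, ⋃ x : V, {a | x ∉ F ∧ x ∈ visitors (n a) (s a) v v} := by
    ext a
    simp only [Set.mem_ofPred_eq, isRecurrent_iff, Set.mem_iInter, Set.mem_iUnion]
    constructor
    · intro h F
      obtain ⟨x, hx, hxF⟩ := h.exists_notMem_finset F
      exact ⟨x, hxF, hx⟩
    · intro h hfin
      obtain ⟨x, hxF, hx⟩ := h hfin.toFinset
      exact hxF (hfin.mem_toFinset.2 hx)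
  rw [this]
  refine MeasurableSet.iInter fun F => MeasurableSet.iUnion fun x => ?_
  refine (MeasurableSet.const (x ∉ F)).inter ((measurableSet_reaches hn hs v x).inter ?_)
  exact measurableSet_exists_lt_and hn hs x v 0

theorem measurable_stopAt (u : V) (k : ℕ) : Measurable fun t : ℕ → V => stopAt u t k := by
  classical
  unfold stopAt
  refine Measurable.ite ?_ measurable_const (measurable_pi_apply k)
  have : {t : ℕ → V | ∃ m ≤ k, t m = u} = ⋃ m, {t | m ≤ k ∧ t m = u} := by
    ext t
    simp
  rw [this]
  exact MeasurableSet.iUnion fun m => (MeasurableSet.const _).inter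
    (measurableSet_eq_fun (measurable_pi_apply m) measurable_const)

theorem measurableSet_mem_arrivals (hn : ∀ x, Measurable fun a => n a x)
    (hs : ∀ x i, Measurable fun a => s a x i) (o u : V) (F : Finset (V × ℕ)) (p : V × ℕ) :
    MeasurableSet {a | p ∈ arrivals (n a) (s a) o u F} := by
  have : {a | p ∈ arrivals (n a) (s a) o u F} = {a | p ∉ F} ∩ ({a | p.2 < n a p.1} ∩
      ({a | Reaches (n a) (stopOutside u F (s a)) o p.1} ∩ ⋃ k, {a | s a p.1 p.2 k = u})) := by
    ext a
    simp [arrivals]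
  rw [this]
  refine (MeasurableSet.const _).inter ((measurableSet_lt measurable_const (hn _)).inter
    ((measurableSet_reaches hn (fun x i j => ?_) _ _).inter (MeasurableSet.iUnion fun k => ?_)))
  · unfold stopOutside
    split_ifs
    · exact (measurable_pi_apply j).comp (hs x i)
    · exact (measurable_stopAt u j).comp (hs x i)
  · exact measurableSet_eq_fun ((measurable_pi_apply k).comp (hs _ _)) measurable_const

end Measurability

/-! ### Laws of Markov chains on path space -/

section ChainLaw

theorem measure_eq_tsum_inter_fiber {α β : Type*} [MeasurableSpace α] [MeasurableSpace β]
    [Countable β] [MeasurableSingletonClass β] (μ : Measure α) {f : α → β} (hf : Measurable f)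
    {A : Set α} (hA : MeasurableSet A) : μ A = ∑' b, μ (A ∩ f ⁻¹' {b}) := by
  rw [← measure_iUnion]
  · congr 1
    ext a
    simp
  · intro b c hbc
    refine Set.disjoint_left.2 fun a ha hb => hbc ?_
    exact ha.2.symm.trans hb.2
  · exact fun b => hA.inter (hf (measurableSet_singleton b))

variable {V : Type*}

/-- The paths which agree with `a` up to time `m`. -/
def pathCylinder (m : ℕ) (a : ℕ → V) : Set (ℕ → V) := {t | ∀ k ≤ m, t k = a k}

/-- The word `b` continued by its last letter. -/
def extendWord {m : ℕ} (b : Finset.Iic m → V) (k : ℕ) : V :=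
  b ⟨min k m, Finset.mem_Iic.2 (min_le_right k m)⟩

theorem frestrictLe_preimage_singleton {m : ℕ} (b : Finset.Iic m → V) :
    Preorder.frestrictLe (π := fun _ => V) m ⁻¹' {b} = pathCylinder m (extendWord b) := by
  ext t
  simp only [Set.mem_preimage, Set.mem_singleton_iff, pathCylinder, funext_iff, extendWord]
  constructor
  · intro h k hk
    rw [← h]
    simp [hk]
  · rintro h ⟨k, hk⟩
    have hk' := Finset.mem_Iic.1 hk
    simpa [hk'] using h k hk'

/-- `Q` is the law of the Markov chain with transition matrix `K` started at `x`. -/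
structure IsChainLaw [MeasurableSpace V] (K : V → V → ℝ) (x : V) (Q : Measure (ℕ → V)) :
    Prop where
  prob : IsProbabilityMeasure Q
  start : ∀ᵐ t ∂Q, t 0 = x
  apply_pathCylinder : ∀ m a, a 0 = x →
    Q (pathCylinder m a) = ∏ k ∈ Finset.range m, ENNReal.ofReal (K (a k) (a (k + 1)))

theorem measurable_shift [MeasurableSpace V] (m : ℕ) :
    Measurable fun (t : ℕ → V) k => t (m + k) := by fun_prop

theorem IsChainLaw.apply_pathCylinder_of_ne [MeasurableSpace V] {K : V → V → ℝ} {x : V}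
    {Q : Measure (ℕ → V)} (hQ : IsChainLaw K x Q) {a : ℕ → V} (ha : a 0 ≠ x) (m : ℕ) :
    Q (pathCylinder m a) = 0 := by
  refine measure_mono_null (fun t ht => ?_) hQ.start
  rw [Set.mem_compl_iff]
  intro h
  exact ha ((ht 0 (Nat.zero_le m)).symm.trans h)

variable [MeasurableSpace V] [Countable V] [DiscreteMeasurableSpace V]

theorem measurableSet_pathCylinder (m : ℕ) (a : ℕ → V) : MeasurableSet (pathCylinder m a) := by
  have : pathCylinder m a = ⋂ k, {t | k ≤ m → t k = a k} := by
    ext t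
    simp [pathCylinder]
  rw [this]
  refine MeasurableSet.iInter fun k => ?_
  by_cases hk : k ≤ m
  · simp only [hk, true_imp_iff]
    exact measurableSet_eq_fun (measurable_pi_apply k) measurable_const
  · simp [hk]

/-- Words of a given length form a countable set, so cylinders determine the marginals on initial
segments of time, and these determine the measure as a projective limit. -/
theorem measure_path_ext {α β : Measure (ℕ → V)} [IsFiniteMeasure α] [IsFiniteMeasure β]
    (h : ∀ m a, α (pathCylinder m a) = β (pathCylinder m a)) : α = β := by
  have hproj : IsProjectiveMeasureFamily fun I : Finset ℕ => β.map I.restrict := by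
    intro I J hJI
    dsimp only
    rw [Measure.map_map (by fun_prop) (by fun_prop)]
    rfl
  refine IsProjectiveLimit.unique (P := fun I : Finset ℕ => β.map I.restrict) ?_ fun I => rfl
  rw [isProjectiveLimit_nat_iff hproj]
  intro m
  refine Measure.ext_of_singleton fun b => ?_
  change _ = β.map (Preorder.frestrictLe (π := fun _ => V) m) {b}
  rw [Measure.map_apply (by fun_prop) (measurableSet_singleton b),
    Measure.map_apply (by fun_prop) (measurableSet_singleton b), frestrictLe_preimage_singleton, h]

namespace IsChainLaw

variable {K : V → V → ℝ} {x y u w : V} {Q Q' : Measure (ℕ → V)}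

theorem unique (hQ : IsChainLaw K x Q) (hQ' : IsChainLaw K x Q') : Q = Q' := by
  have := hQ.prob
  have := hQ'.prob
  refine measure_path_ext fun m a => ?_
  by_cases ha : a 0 = x
  · rw [hQ.apply_pathCylinder m a ha, hQ'.apply_pathCylinder m a ha]
  · rw [hQ.apply_pathCylinder_of_ne ha, hQ'.apply_pathCylinder_of_ne ha]

/-- The Markov property at time `m`. -/
theorem markov {Q : V → Measure (ℕ → V)} (hQ : ∀ x, IsChainLaw K x (Q x)) (x : V) (m : ℕ)
    (a : ℕ → V) {D : Set (ℕ → V)} (hD : MeasurableSet D) :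
    Q x (pathCylinder m a ∩ (fun t k => t (m + k)) ⁻¹' D) =
      Q x (pathCylinder m a) * Q (a m) D := by
  have := (hQ x).prob
  have := (hQ (a m)).prob
  have hfin : IsFiniteMeasure (Q x (pathCylinder m a) • Q (a m)) :=
    Measure.smul_finite _ (measure_ne_top _ _)
  -- Both sides are finite measures in `D`, so it is enough to compare cylinders; there the words
  -- `a` and `b` concatenate to `c` and the product of transition probabilities splits at `m`.
  have key : ((Q x).restrict (pathCylinder m a)).map (fun t k => t (m + k)) =
      Q x (pathCylinder m a) • Q (a m) := by
    refine measure_path_ext fun l b => ?_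
    rw [Measure.map_apply (measurable_shift m) (measurableSet_pathCylinder l b),
      Measure.restrict_apply (measurable_shift m (measurableSet_pathCylinder l b)),
      Measure.smul_apply, smul_eq_mul]
    by_cases ha : a 0 = x
    · by_cases hb : b 0 = a m
      · set c : ℕ → V := fun k => if k ≤ m then a k else b (k - m) with hc
        have hcm : ∀ k, c (m + k) = b k := by
          intro k
          rcases Nat.eq_zero_or_pos k with rfl | hk
          · simp [hc, hb]
          · have : ¬ m + k ≤ m := by omega
            simp [hc, this]
        have hca : ∀ k ≤ m, c k = a k := fun k hk => by simp [hc, hk]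
        have hset : (fun (t : ℕ → V) k => t (m + k)) ⁻¹' pathCylinder l b ∩ pathCylinder m a =
            pathCylinder (m + l) c := by
          ext t
          constructor
          · rintro ⟨h1, h2⟩ k hk
            rcases le_total k m with hkm | hkm
            · rw [hca k hkm, h2 k hkm]
            · obtain ⟨j, rfl⟩ := Nat.exists_eq_add_of_le hkm
              rw [hcm]
              exact h1 j (by omega)
          · intro h
            refine ⟨fun k hk => ?_, fun k hk => ?_⟩
            · rw [← hcm]
              exact h (m + k) (by omega)
            · rw [← hca k hk]
              exact h k (by omega)
        rw [hset, (hQ x).apply_pathCylinder _ _ ((hca 0 (Nat.zero_le m)).trans ha),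
          (hQ x).apply_pathCylinder _ _ ha, (hQ (a m)).apply_pathCylinder _ _ hb,
          Finset.prod_range_add]
        congr 1
        · refine Finset.prod_congr rfl fun k hk => ?_
          have := Finset.mem_range.1 hk
          rw [hca k (by omega), hca (k + 1) (by omega)]
        · refine Finset.prod_congr rfl fun k _ => ?_
          rw [hcm, add_assoc, hcm]
      · rw [(hQ (a m)).apply_pathCylinder_of_ne hb, mul_zero]
        convert measure_empty (μ := Q x)
        refine Set.eq_empty_iff_forall_notMem.2 fun t ht => hb ?_
        exact (ht.1 0 (Nat.zero_le l)).symm.trans (ht.2 m le_rfl)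
    · rw [(hQ x).apply_pathCylinder_of_ne ha, zero_mul]
      exact measure_mono_null Set.inter_subset_right ((hQ x).apply_pathCylinder_of_ne ha m)
  have h := congrArg (fun ν => ν D) key
  rwa [Measure.map_apply (measurable_shift m) hD,
    Measure.restrict_apply (measurable_shift m hD), Set.inter_comm, Measure.smul_apply,
    smul_eq_mul] at h

theorem measurableSet_avoid (w : V) : MeasurableSet {t : ℕ → V | ∀ k, t k ≠ w} := by
  have : {t : ℕ → V | ∀ k, t k ≠ w} = ⋂ k, {t | t k = w}ᶜ := by
    ext t
    simp
  rw [this]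
  exact MeasurableSet.iInter fun k =>
    (measurableSet_eq_fun (measurable_pi_apply k) measurable_const).compl

/-- A chain which is known to visit `u` still avoids `w` with at most the probability with which a
chain started at `u` does so, whatever is known about it up to its first visit to `u`. -/
theorem inter_avoid_le {Q : V → Measure (ℕ → V)} (hQ : ∀ x, IsChainLaw K x (Q x)) (x u w : V)
    {C : Set (ℕ → V)} (hC : MeasurableSet C)
    (hsat : ∀ t t', stopAt u t = stopAt u t' → t ∈ C → t' ∈ C) (hu : ∀ t ∈ C, ∃ k, t k = u) :
    Q x (C ∩ {t | ∀ k, t k ≠ w}) ≤ Q x C * Q u {t | ∀ k, t k ≠ w} := by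
  set N : Set (ℕ → V) := {t | ∀ k, t k ≠ w} with hN
  have hNm : MeasurableSet N := measurableSet_avoid w
  -- `T m` is the event that the first visit to `u` takes place at time `m`.
  set T : ℕ → Set (ℕ → V) := fun m => {t | t m = u ∧ ∀ k < m, t k ≠ u} with hT
  have hTm : ∀ m, MeasurableSet (T m) := by
    intro m
    have : T m = {t | t m = u} ∩ ⋂ k, {t | k < m → t k ≠ u} := by
      ext t
      simp [hT]
    rw [this]
    refine (measurableSet_eq_fun (measurable_pi_apply m) measurable_const).inter
      (MeasurableSet.iInter fun k => ?_)
    by_cases hk : k < m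
    · simp only [hk, true_imp_iff]
      exact (measurableSet_eq_fun (measurable_pi_apply k) measurable_const).compl
    · simp [hk]
  have hTd : Pairwise (Function.onFun Disjoint T) := by
    intro m l hml
    refine Set.disjoint_left.2 fun t hm hl => ?_
    rcases lt_or_gt_of_ne hml with h | h
    · exact hl.2 m h hm.1
    · exact hm.2 l h hl.1
  have hCT : C = ⋃ m, C ∩ T m := by
    rw [← Set.inter_iUnion, eq_comm, Set.inter_eq_left]
    intro t ht
    classical
    have h := hu t ht
    exact Set.mem_iUnion.2 ⟨Nat.find h, Nat.find_spec h, fun k hk => Nat.find_min h hk⟩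
  have hsum : ∀ A : Set (ℕ → V), MeasurableSet A → Q x (C ∩ A) = ∑' m, Q x (C ∩ T m ∩ A) := by
    intro A hA
    conv_lhs => rw [hCT, Set.iUnion_inter]
    refine measure_iUnion (fun m l hml => ?_) fun m => (hC.inter (hTm m)).inter hA
    exact (hTd hml).mono (fun t ht => ht.1.2) fun t ht => ht.1.2
  have hsumC : Q x C = ∑' m, Q x (C ∩ T m) := by simpa using hsum Set.univ MeasurableSet.univ
  rw [hsum N hNm, hsumC, ← ENNReal.tsum_mul_right]
  refine ENNReal.tsum_le_tsum fun m => ?_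
  rw [measure_eq_tsum_inter_fiber (Q x) (f := Preorder.frestrictLe (π := fun _ => V) m)
    (by fun_prop) ((hC.inter (hTm m)).inter hNm), measure_eq_tsum_inter_fiber (Q x)
    (f := Preorder.frestrictLe (π := fun _ => V) m) (by fun_prop) (hC.inter (hTm m)),
    ← ENNReal.tsum_mul_right]
  refine ENNReal.tsum_le_tsum fun b => ?_
  rw [frestrictLe_preimage_singleton]
  set a := extendWord b
  by_cases hne : ∃ t, t ∈ C ∩ T m ∩ pathCylinder m a
  · obtain ⟨t, ⟨htC, htT⟩, hta⟩ := hne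
    have hau : a m = u := (hta m le_rfl).symm.trans htT.1
    -- Once the word `a` ends with the first visit to `u`, it determines the stopped path, so `hsat`
    -- puts the whole cylinder into `C` and the Markov property applies at time `m`.
    have hsub : pathCylinder m a ⊆ C ∩ T m := by
      intro t' ht'
      have heq : ∀ k ≤ m, t' k = t k := fun k hk => (ht' k hk).trans (hta k hk).symm
      refine ⟨hsat t t' ?_ htC, (heq m le_rfl).trans htT.1, fun k hk => ?_⟩
      · funext k
        rcases le_total k m with hk | hk
        · rw [stopAt_apply_of_forall_lt fun l hl => htT.2 l (by omega),
            stopAt_apply_of_forall_lt fun l hl => ?_, heq k hk]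
          rw [heq l (by omega)]
          exact htT.2 l (by omega)
        · rw [stopAt_apply_eq_iff.2 ⟨m, hk, htT.1⟩,
            stopAt_apply_eq_iff.2 ⟨m, hk, (heq m le_rfl).trans htT.1⟩]
      · rw [heq k hk.le]
        exact htT.2 k hk
    rw [Set.inter_eq_right.2 hsub, ← hau, ← markov hQ x m a hNm]
    exact measure_mono fun t ht => ⟨ht.2, fun k => ht.1.2 (m + k)⟩
  · refine le_of_eq_of_le (measure_mono_null (t := ∅) (fun t ht => hne ⟨t, ht.1.1, ht.2⟩) ?_)
      zero_le
    exact measure_empty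

/-- Some word from `u` to `w` has only positive transition probabilities; its cylinder has positive
probability and consists of paths that visit `w`. -/
theorem avoid_lt_one (hQ : IsChainLaw K u Q) (h : Relation.ReflTransGen (fun a b => 0 < K a b) u w) :
    Q {t | ∀ k, t k ≠ w} < 1 := by
  have := hQ.prob
  have key : ∃ (m : ℕ) (a : ℕ → V), a 0 = u ∧ a m = w ∧ ∀ k < m, 0 < K (a k) (a (k + 1)) := by
    induction h with
    | refl => exact ⟨0, fun _ => u, rfl, rfl, fun k hk => absurd hk (Nat.not_lt_zero k)⟩
    | @tail y z _ hyz ih =>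
      obtain ⟨m, a, h0, hm, ha⟩ := ih
      refine ⟨m + 1, fun k => if k ≤ m then a k else z, by simp [h0], by simp, fun k hk => ?_⟩
      have hk' : k ≤ m := by omega
      rcases hk'.lt_or_eq with h | rfl
      · have : k + 1 ≤ m := h
        simpa [hk', this] using ha k h
      · simpa [hm] using hyz
  obtain ⟨m, a, h0, hm, ha⟩ := key
  have hpos : 0 < Q (pathCylinder m a) := by
    rw [hQ.apply_pathCylinder m a h0, pos_iff_ne_zero, Finset.prod_ne_zero_iff]
    intro k hk
    exact (ENNReal.ofReal_pos.2 (ha k (Finset.mem_range.1 hk))).ne'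
  have hsub : {t : ℕ → V | ∀ k, t k ≠ w} ⊆ (pathCylinder m a)ᶜ := by
    intro t ht hta
    exact ht m ((hta m le_rfl).trans hm)
  refine (measure_mono hsub).trans_lt ?_
  rw [prob_compl_eq_one_sub (measurableSet_pathCylinder m a)]
  exact ENNReal.sub_lt_self ENNReal.one_ne_top one_ne_zero hpos.ne'

/-- The law of the chain is equivariant under symmetries of the transition matrix. -/
theorem map_perm {Q : V → Measure (ℕ → V)} (hQ : ∀ x, IsChainLaw K x (Q x)) {φ : Equiv.Perm V}
    (hφ : ∀ u v, K (φ u) (φ v) = K u v) (x : V) : Q (φ x) = (Q x).map (fun t k => φ (t k)) := by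
  have := (hQ x).prob
  have hm : Measurable fun (t : ℕ → V) k => φ (t k) :=
    measurable_pi_iff.2 fun k => (measurable_of_countable φ).comp (measurable_pi_apply k)
  refine (hQ (φ x)).unique ⟨Measure.isProbabilityMeasure_map hm.aemeasurable, ?_, ?_⟩
  · rw [ae_map_iff hm.aemeasurable (measurableSet_eq_fun (measurable_pi_apply 0) measurable_const)]
    filter_upwards [(hQ x).start] with t ht
    rw [ht]
  · intro m a ha
    have hset : (fun (t : ℕ → V) k => φ (t k)) ⁻¹' pathCylinder m a =
        pathCylinder m fun k => φ.symm (a k) := by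
      ext t
      simp [pathCylinder, Equiv.eq_symm_apply]
    rw [Measure.map_apply hm (measurableSet_pathCylinder m a), hset,
      (hQ x).apply_pathCylinder m _ (by simp [ha])]
    refine Finset.prod_congr rfl fun k _ => ?_
    rw [← hφ, Equiv.apply_symm_apply, Equiv.apply_symm_apply]

/-- Decomposition according to the first step: avoiding a set is harder from time `0` on than from
time `1` on. -/
theorem avoid_le_tsum {Q : V → Measure (ℕ → V)} (hQ : ∀ x, IsChainLaw K x (Q x)) (R : Set V)
    (x : V) : Q x {t | ∀ k, t k ∉ R} ≤
      ∑' y, ENNReal.ofReal (K x y) * Q y {t | ∀ k, t k ∉ R} := by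
  have hm : MeasurableSet {t : ℕ → V | ∀ k, t k ∉ R} := by
    have : {t : ℕ → V | ∀ k, t k ∉ R} = ⋂ k, (fun t => t k) ⁻¹' Rᶜ := by
      ext t
      simp
    rw [this]
    exact MeasurableSet.iInter fun k => measurable_pi_apply k (MeasurableSet.of_discrete)
  rw [measure_eq_tsum_inter_fiber (Q x) (measurable_pi_apply 1) hm]
  refine ENNReal.tsum_le_tsum fun y => ?_
  set a : ℕ → V := fun k => if k = 0 then x else y with ha
  have h1 : Q x (pathCylinder 1 a) = ENNReal.ofReal (K x y) := by
    rw [(hQ x).apply_pathCylinder 1 a rfl]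
    simp [ha]
  have h2 := markov hQ x 1 a hm
  rw [h1, show a 1 = y by simp [ha]] at h2
  rw [← h2]
  refine measure_mono_ae ?_
  filter_upwards [(hQ x).start] with t ht hmem
  refine ⟨fun k hk => ?_, fun k => hmem.1 (1 + k)⟩
  rcases Nat.le_one_iff_eq_zero_or_eq_one.1 hk with rfl | rfl
  · simpa [ha] using ht
  · simpa [ha] using hmem.2

end IsChainLaw

end ChainLaw

/-! ### Product laws of configurations and resampling of one frog -/

section Product

/-- On a box the fresh value supplies the factor of index `j` and the old point supplies the
remaining factors. -/
theorem infinitePi_resample {ι : Type*} [DecidableEq ι] {X : ι → Type*}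
    [∀ i, MeasurableSpace (X i)] (μ : ∀ i, Measure (X i)) [∀ i, IsProbabilityMeasure (μ i)]
    (j : ι) : ((Measure.infinitePi μ).prod (μ j)).map (fun p => Function.update p.1 j p.2) =
      Measure.infinitePi μ := by
  refine Measure.eq_infinitePi μ fun s t ht => ?_
  rw [Measure.map_apply measurable_update' (.pi s.countable_toSet fun _ _ => ht _)]
  have hset : (fun p : (∀ i, X i) × X j => Function.update p.1 j p.2) ⁻¹' ((s : Set ι).pi t) =
      (((s.erase j : Finset ι) : Set ι).pi t) ×ˢ (if j ∈ s then t j else Set.univ) := by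
    ext ⟨f, a⟩
    simp only [Set.mem_preimage, Set.mem_pi, Set.mem_prod, Finset.mem_coe, Finset.mem_erase]
    constructor
    · intro h
      refine ⟨fun i hi => by simpa [hi.1] using h i hi.2, ?_⟩
      split_ifs with hj
      · simpa using h j hj
      · trivial
    · rintro ⟨h1, h2⟩ i hi
      by_cases hij : i = j
      · subst hij
        simpa [hi] using h2
      · simpa [hij] using h1 i ⟨hij, hi⟩
  rw [hset, Measure.prod_prod, Measure.infinitePi_pi _ fun i _ => ht i]
  split_ifs with hj
  · exact Finset.prod_erase_mul s (fun i => μ i (t i)) hj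
  · rw [measure_univ, mul_one, Finset.erase_eq_of_notMem hj]

/-- Configurations of frogs: the first component at `Sum.inl x` is the number of frogs at `x`, the
second component at `Sum.inr (x, i)` is the trajectory of the frog number `i` from `x`. -/
abbrev Config (V : Type*) := V ⊕ V × ℕ → ℕ × (ℕ → V)

variable {V : Type*}

/-- The frog numbers of a configuration. -/
def num (ω : Config V) (x : V) : ℕ := (ω (Sum.inl x)).1

/-- The trajectories of a configuration. -/
def path (ω : Config V) (x : V) (i : ℕ) : ℕ → V := (ω (Sum.inr (x, i))).2

/-- The configuration in which the frog `p` takes the trajectory `t`. -/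
noncomputable def reroute (p : V × ℕ) (ω : Config V) (t : ℕ → V) : Config V :=
  open Classical in Function.update ω (Sum.inr p) (0, t)

theorem num_reroute (p : V × ℕ) (ω : Config V) (t : ℕ → V) : num (reroute p ω t) = num ω := by
  funext x
  simp [num, reroute]

theorem path_reroute_self (p : V × ℕ) (ω : Config V) (t : ℕ → V) :
    path (reroute p ω t) p.1 p.2 = t := by
  simp [path, reroute]

theorem path_reroute_of_ne {p : V × ℕ} (ω : Config V) (t : ℕ → V) {x : V} {i : ℕ}
    (h : (x, i) ≠ p) : path (reroute p ω t) x i = path ω x i := by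
  simp [path, reroute, h]

/-- The independent laws `Λ` of the frog numbers and of the trajectories, the latter being chains
with laws `Q`. -/
structure IsFrogLaw [MeasurableSpace V] (K : V → V → ℝ) (Q : V → Measure (ℕ → V))
    (Λ : V ⊕ V × ℕ → Measure (ℕ × (ℕ → V))) : Prop where
  prob : ∀ j, IsProbabilityMeasure (Λ j)
  chain : ∀ x, IsChainLaw K x (Q x)
  frog : ∀ p, Λ (Sum.inr p) = (Q p.1).map (Prod.mk 0)
  -- The idle path at `Sum.inl x` will be constant at `x`, so that `φ` carries it to the one at `φ
  -- x`; what remains is that the frog numbers are identically distributed.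
  number : ∀ x (φ : Equiv.Perm V), Λ (Sum.inl (φ x)) =
    (Λ (Sum.inl x)).map (Prod.map id fun t k => φ (t k))

variable [MeasurableSpace V]

theorem measurable_num (x : V) : Measurable fun ω : Config V => num ω x :=
  measurable_fst.comp (measurable_pi_apply _)

theorem measurable_path (x : V) (i : ℕ) : Measurable fun ω : Config V => path ω x i :=
  measurable_snd.comp (measurable_pi_apply _)

theorem measurable_path_apply (x : V) (i j : ℕ) : Measurable fun ω : Config V => path ω x i j :=
  (measurable_pi_apply j).comp (measurable_path x i)

theorem measurable_reroute (p : V × ℕ) :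
    Measurable fun q : Config V × (ℕ → V) => reroute p q.1 q.2 := by
  classical
  have h : Measurable fun q : Config V × (ℕ → V) => (q.1, ((0 : ℕ), q.2)) := by fun_prop
  have h2 := (measurable_update' (X := fun _ : V ⊕ V × ℕ => ℕ × (ℕ → V)) (a := Sum.inr p)).comp h
  convert h2 using 1
  funext q
  simp only [reroute, Function.comp_def]

namespace IsFrogLaw

variable {K : V → V → ℝ} {Q : V → Measure (ℕ → V)} {Λ : V ⊕ V × ℕ → Measure (ℕ × (ℕ → V))}

theorem isProbabilityMeasure (L : IsFrogLaw K Q Λ) :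
    IsProbabilityMeasure (Measure.infinitePi Λ) := by
  have := L.prob
  infer_instance

theorem map_reroute (L : IsFrogLaw K Q Λ) (p : V × ℕ) :
    ((Measure.infinitePi Λ).prod (Q p.1)).map (fun q => reroute p q.1 q.2) =
      Measure.infinitePi Λ := by
  classical
  have := L.prob
  have := (L.chain p.1).prob
  conv_rhs => rw [← infinitePi_resample Λ (Sum.inr p), L.frog p]
  have hmap : (Measure.infinitePi Λ).prod ((Q p.1).map (Prod.mk 0)) =
      ((Measure.infinitePi Λ).prod (Q p.1)).map (Prod.map id (Prod.mk (0 : ℕ))) := by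
    rw [← Measure.map_prod_map _ _ measurable_id (by fun_prop), Measure.map_id]
  rw [hmap, Measure.map_map measurable_update' (by fun_prop)]
  congr 1

/-- The form in which resampling is used: everything but the path of `p` is frozen, and that path is
drawn afresh. -/
theorem apply_eq_lintegral_reroute (L : IsFrogLaw K Q Λ) (p : V × ℕ) {A : Set (Config V)}
    (hA : MeasurableSet A) : Measure.infinitePi Λ A =
      ∫⁻ ω, Q p.1 (reroute p ω ⁻¹' A) ∂Measure.infinitePi Λ := by
  have := L.isProbabilityMeasure
  have := (L.chain p.1).prob
  conv_lhs => rw [← L.map_reroute p]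
  rw [Measure.map_apply (measurable_reroute p) hA, Measure.prod_apply (measurable_reroute p hA)]
  rfl

theorem ae_path (L : IsFrogLaw K Q Λ) (p : V × ℕ) {S : Set (ℕ → V)} (hS : MeasurableSet S)
    (h : ∀ᵐ t ∂Q p.1, t ∈ S) : ∀ᵐ ω ∂Measure.infinitePi Λ, path ω p.1 p.2 ∈ S := by
  have hm : MeasurableSet {ω : Config V | path ω p.1 p.2 ∈ Sᶜ} := measurable_path _ _ hS.compl
  change Measure.infinitePi Λ {ω : Config V | path ω p.1 p.2 ∈ Sᶜ} = 0
  rw [L.apply_eq_lintegral_reroute p hm]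
  refine (lintegral_congr fun ω => ?_).trans lintegral_zero
  refine measure_mono_null (fun t ht => ?_) h
  have ht' : path (reroute p ω t) p.1 p.2 ∈ Sᶜ := ht
  rwa [path_reroute_self] at ht'

variable [Countable V] [DiscreteMeasurableSpace V]

theorem ae_start (L : IsFrogLaw K Q Λ) :
    ∀ᵐ ω ∂Measure.infinitePi Λ, ∀ x i, path ω x i 0 = x := by
  rw [ae_all_iff]
  intro x
  rw [ae_all_iff]
  intro i
  exact L.ae_path (x, i) (S := {t | t 0 = x})
    (measurableSet_eq_fun (measurable_pi_apply 0) measurable_const) (L.chain x).start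

end IsFrogLaw

end Product

/-! ### Infinitely many visits spread from one site to all sites -/

section Spreading

variable {V : Type*}

/-- The event `B` depends only on the frog numbers, on the trajectories of the frogs in `F`, and on
the trajectories of the other frogs up to their first visit to `u`. -/
def DependsOnStopped (u : V) (F : Finset (V × ℕ)) (B : Set (Config V)) : Prop :=
  ∀ ω ω', num ω = num ω' → (∀ p ∈ F, path ω p.1 p.2 = path ω' p.1 p.2) →
    (∀ p : V × ℕ, stopAt u (path ω p.1 p.2) = stopAt u (path ω' p.1 p.2)) → ω ∈ B → ω' ∈ B

/-- The frog `p` is the first one, in the enumeration `e`, to arrive at `u`. -/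
def IsFirstArrival (e : V × ℕ → ℕ) (ω : Config V) (o u : V) (F : Finset (V × ℕ)) (p : V × ℕ) :
    Prop :=
  p ∈ arrivals (num ω) (path ω) o u F ∧ ∀ q ∈ arrivals (num ω) (path ω) o u F, e p ≤ e q

/-- Whether a frog ever visits `u` can be read off its stopped path, and the activations that count
for `arrivals` involve no more than stopped paths outside `F`. -/
theorem arrivals_congr {ω ω' : Config V} {o u : V} {F : Finset (V × ℕ)} (hn : num ω = num ω')
    (hF : ∀ p ∈ F, path ω p.1 p.2 = path ω' p.1 p.2)
    (hs : ∀ p : V × ℕ, stopAt u (path ω p.1 p.2) = stopAt u (path ω' p.1 p.2)) :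
    arrivals (num ω) (path ω) o u F = arrivals (num ω') (path ω') o u F := by
  have h : stopOutside u F (path ω) = stopOutside u F (path ω') := by
    funext x i
    rw [stopOutside, stopOutside]
    split_ifs with hp
    · exact hF _ hp
    · exact hs (x, i)
  ext p
  simp only [arrivals, hn, h]
  refine and_congr_right fun _ => and_congr_right fun _ => and_congr_right fun _ => ?_
  exact ⟨exists_eq_of_stopAt_eq (hs p), exists_eq_of_stopAt_eq (hs p).symm⟩

theorem dependsOnStopped_isFirstArrival (e : V × ℕ → ℕ) (o u : V) (F : Finset (V × ℕ))
    (p : V × ℕ) : DependsOnStopped u F {ω | IsFirstArrival e ω o u F p} := by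
  intro ω ω' hn hF hs h
  have := arrivals_congr (o := o) hn hF hs
  simpa only [IsFirstArrival, this, Set.mem_ofPred_eq] using h

theorem DependsOnStopped.inter {u : V} {F : Finset (V × ℕ)} {B B' : Set (Config V)}
    (hB : DependsOnStopped u F B) (hB' : DependsOnStopped u F B') :
    DependsOnStopped u F (B ∩ B') := fun ω ω' hn hF hs h =>
  ⟨hB ω ω' hn hF hs h.1, hB' ω ω' hn hF hs h.2⟩

theorem DependsOnStopped.mono {u : V} {F F' : Finset (V × ℕ)} {B : Set (Config V)}
    (hB : DependsOnStopped u F B) (hF' : F ⊆ F') : DependsOnStopped u F' B :=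
  fun ω ω' hn hF hs => hB ω ω' hn (fun p hp => hF p (hF' hp)) hs

theorem dependsOnStopped_path (u : V) {F : Finset (V × ℕ)} {p : V × ℕ} (hp : p ∈ F)
    (S : Set (ℕ → V)) : DependsOnStopped u F ((fun ω => path ω p.1 p.2) ⁻¹' S) := by
  intro ω ω' _ hF _ h
  rwa [Set.mem_preimage, ← hF p hp]

variable [MeasurableSpace V] [Countable V] [DiscreteMeasurableSpace V]

theorem measurableSet_isFirstArrival (e : V × ℕ → ℕ) (o u : V) (F : Finset (V × ℕ)) (p : V × ℕ) :
    MeasurableSet {ω : Config V | IsFirstArrival e ω o u F p} := by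
  have hm : ∀ q, MeasurableSet {ω : Config V | q ∈ arrivals (num ω) (path ω) o u F} :=
    measurableSet_mem_arrivals measurable_num measurable_path o u F
  have : {ω : Config V | IsFirstArrival e ω o u F p} =
      {ω : Config V | p ∈ arrivals (num ω) (path ω) o u F} ∩
        ⋂ q, ({ω : Config V | q ∈ arrivals (num ω) (path ω) o u F}ᶜ ∪ {_ω | e p ≤ e q}) := by
    ext ω
    simp [IsFirstArrival, imp_iff_not_or]
  rw [this]
  exact (hm p).inter (MeasurableSet.iInter fun q => (hm q).compl.union (MeasurableSet.const _))

namespace IsFrogLaw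

variable {K : V → V → ℝ} {Q : V → Measure (ℕ → V)} {Λ : V ⊕ V × ℕ → Measure (ℕ × (ℕ → V))}

/-- With all other frogs frozen, `B` sees the path of `p ∉ F` only up to its first visit to `u`, so
`IsChainLaw.inter_avoid_le` applies to almost no more than the resampled path and is then
integrated. -/
theorem inter_avoid_le (L : IsFrogLaw K Q Λ) {u : V} (w : V) {F : Finset (V × ℕ)} {p : V × ℕ}
    (hp : p ∉ F) {B : Set (Config V)} (hB : MeasurableSet B) (hdep : DependsOnStopped u F B)
    (hu : ∀ ω ∈ B, ∃ k, path ω p.1 p.2 k = u) :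
    Measure.infinitePi Λ (B ∩ (fun ω => path ω p.1 p.2) ⁻¹' {t | ∀ k, t k ≠ w}) ≤
      Q u {t | ∀ k, t k ≠ w} * Measure.infinitePi Λ B := by
  rw [L.apply_eq_lintegral_reroute p hB, L.apply_eq_lintegral_reroute p
    (hB.inter (measurable_path _ _ (IsChainLaw.measurableSet_avoid w))),
    ← lintegral_const_mul' _ _ ?_]
  · refine lintegral_mono fun ω => ?_
    have hm : Measurable (reroute p ω) := (measurable_reroute p).comp measurable_prodMk_left
    have := IsChainLaw.inter_avoid_le L.chain p.1 u w (hm hB) (fun t t' htt' ht => ?_)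
      (fun t ht => by simpa only [path_reroute_self] using hu _ ht)
    · rw [mul_comm]
      refine le_of_eq_of_le ?_ this
      congr 1
      ext t
      simp only [Set.mem_preimage, Set.mem_inter_iff, Set.mem_ofPred_eq, path_reroute_self]
    · refine hdep _ _ (by rw [num_reroute, num_reroute]) (fun q hq => ?_) (fun q => ?_) ht
      · have hqp : q ≠ p := fun h => hp (h ▸ hq)
        rw [path_reroute_of_ne _ _ hqp, path_reroute_of_ne _ _ hqp]
      · by_cases hqp : q = p
        · subst hqp
          rwa [path_reroute_self, path_reroute_self]
        · rw [path_reroute_of_ne _ _ hqp, path_reroute_of_ne _ _ hqp]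
  · have := (L.chain u).prob
    exact measure_ne_top _ _

/-- Each further arrival at `u` has a chance to visit `w` which does not depend on the past. -/
theorem measure_arrivals_avoid_le (L : IsFrogLaw K Q Λ) (o u w : V) (m : ℕ) :
    ∀ (F : Finset (V × ℕ)) (B : Set (Config V)), MeasurableSet B → DependsOnStopped u F B →
      Measure.infinitePi Λ (B ∩ {ω | ∀ F', F ⊆ F' →
        (arrivals (num ω) (path ω) o u F').Nonempty ∧
          ∀ p ∈ arrivals (num ω) (path ω) o u F', ∀ k, path ω p.1 p.2 k ≠ w}) ≤
        Q u {t | ∀ k, t k ≠ w} ^ m * Measure.infinitePi Λ B := by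
  classical
  -- An injective enumeration singles out one arrival, which makes the events `B₁ p` disjoint.
  obtain ⟨e, he⟩ := Countable.exists_injective_nat (V × ℕ)
  induction m with
  | zero =>
    intro F B _ _
    rw [pow_zero, one_mul]
    exact measure_mono Set.inter_subset_left
  | succ m ih =>
    intro F B hB hdep
    set μ := Measure.infinitePi Λ
    set c := Q u {t | ∀ k, t k ≠ w}
    set N : Finset (V × ℕ) → Set (Config V) := fun F => {ω | ∀ F', F ⊆ F' →
        (arrivals (num ω) (path ω) o u F').Nonempty ∧
          ∀ p ∈ arrivals (num ω) (path ω) o u F', ∀ k, path ω p.1 p.2 k ≠ w} with hN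
    set B₁ : V × ℕ → Set (Config V) := fun p => B ∩ {ω | IsFirstArrival e ω o u F p} with hB₁
    set B₂ : V × ℕ → Set (Config V) :=
      fun p => B₁ p ∩ (fun ω => path ω p.1 p.2) ⁻¹' {t | ∀ k, t k ≠ w} with hB₂
    have hB₁m : ∀ p, MeasurableSet (B₁ p) := fun p =>
      hB.inter (measurableSet_isFirstArrival e o u F p)
    have hB₁d : ∀ p, DependsOnStopped u F (B₁ p) := fun p =>
      hdep.inter (dependsOnStopped_isFirstArrival e o u F p)
    have hcover : B ∩ N F ⊆ ⋃ p, (B₂ p ∩ N (insert p F)) := by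
      rintro ω ⟨hωB, hωN⟩
      obtain ⟨hne, havoid⟩ := hωN F subset_rfl
      obtain ⟨p, hp, hmin⟩ := exists_minimalFor_of_wellFoundedLT
        (fun p => p ∈ arrivals (num ω) (path ω) o u F) e hne
      refine Set.mem_iUnion.2 ⟨p, ⟨⟨hωB, hp, fun q hq => ?_⟩, havoid p hp⟩,
        fun F' hF' => hωN F' ((Finset.subset_insert p F).trans hF')⟩
      exact (le_total (e p) (e q)).elim id fun h => hmin hq h
    have hdisj : Pairwise (Function.onFun Disjoint B₁) := by
      intro p q hpq
      refine Set.disjoint_left.2 fun ω hp hq => hpq (he ?_)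
      exact le_antisymm (hp.2.2 q hq.2.1) (hq.2.2 p hp.2.1)
    calc μ (B ∩ N F) ≤ ∑' p, μ (B₂ p ∩ N (insert p F)) :=
          (measure_mono hcover).trans (measure_iUnion_le _)
      _ ≤ ∑' p, c ^ m * (c * μ (B₁ p)) := by
          refine ENNReal.tsum_le_tsum fun p => ?_
          -- `B₂ p` reveals the whole path of `p`; this is allowed because `p` joins the set of
          -- frogs that are no longer stopped.
          refine (ih (insert p F) (B₂ p) ?_ ?_).trans ?_
          · exact (hB₁m p).inter (measurable_path _ _ (IsChainLaw.measurableSet_avoid w))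
          · exact ((hB₁d p).mono (Finset.subset_insert p F)).inter
              (dependsOnStopped_path u (Finset.mem_insert_self p F) _)
          · refine mul_le_mul_right ?_ _
            by_cases hp : p ∈ F
            · have : B₂ p = ∅ := Set.eq_empty_iff_forall_notMem.2 fun ω hω => hω.1.2.1.1 hp
              rw [this, measure_empty]
              exact zero_le
            · exact L.inter_avoid_le w hp (hB₁m p) (hB₁d p) fun ω hω => hω.2.1.2.2.2
      _ = c ^ (m + 1) * ∑' p, μ (B₁ p) := by
          simp_rw [← mul_assoc, ← pow_succ]
          rw [ENNReal.tsum_mul_left]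
      _ ≤ c ^ (m + 1) * μ B := by
          refine mul_le_mul_right ?_ _
          rw [← measure_iUnion hdisj hB₁m]
          exact measure_mono (Set.iUnion_subset fun p => Set.inter_subset_left)

/-- Almost surely, if infinitely many activated sites send a frog to one site, then so they do to
every site. -/
theorem ae_spreading (L : IsFrogLaw K Q Λ) (hKirr : IsIrreducible K) :
    ∀ᵐ ω ∂Measure.infinitePi Λ, Spreading (num ω) (path ω) := by
  have hnull : ∀ o u w (F : Finset (V × ℕ)), Measure.infinitePi Λ {ω | ∀ F', F ⊆ F' →
        (arrivals (num ω) (path ω) o u F').Nonempty ∧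
          ∀ p ∈ arrivals (num ω) (path ω) o u F', ∀ k, path ω p.1 p.2 k ≠ w} = 0 := by
    intro o u w F
    have h : ∀ m, Measure.infinitePi Λ {ω | ∀ F', F ⊆ F' →
        (arrivals (num ω) (path ω) o u F').Nonempty ∧
          ∀ p ∈ arrivals (num ω) (path ω) o u F', ∀ k, path ω p.1 p.2 k ≠ w} ≤
        Q u {t | ∀ k, t k ≠ w} ^ m := by
      intro m
      have := L.isProbabilityMeasure
      have h := L.measure_arrivals_avoid_le o u w m F Set.univ MeasurableSet.univ
        fun _ _ _ _ _ _ => trivial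
      rwa [Set.univ_inter, measure_univ, mul_one] at h
    have hlim := ENNReal.tendsto_pow_atTop_nhds_zero_of_lt_one
      ((L.chain u).avoid_lt_one (hKirr u w))
    exact le_antisymm (ge_of_tendsto' hlim h) zero_le
  have hall : ∀ᵐ ω ∂Measure.infinitePi Λ, ∀ o u w, ∀ F : Finset (V × ℕ), ¬ ∀ F', F ⊆ F' →
        (arrivals (num ω) (path ω) o u F').Nonempty ∧
          ∀ p ∈ arrivals (num ω) (path ω) o u F', ∀ k, path ω p.1 p.2 k ≠ w := by
    simp_rw [ae_all_iff]
    intro o u w F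
    refine measure_mono_null (fun ω hω => ?_) (hnull o u w F)
    exact not_not.1 hω
  filter_upwards [hall, L.ae_start] with ω hω hstart o u w hu hw
  obtain ⟨F, hF⟩ := exists_forall_arrivals hstart hu hw
  exact hω o u w F hF

end IsFrogLaw

end Spreading

/-! ### Symmetries of the transition matrix and the zero-one law for invariant events -/

section Symmetry

open scoped Pointwise

variable {V : Type*}

/-- The symmetries of the matrix `K`. -/
def symmetries (K : V → V → ℝ) : Subgroup (Equiv.Perm V) where
  carrier := {φ | ∀ u v, K (φ u) (φ v) = K u v}
  one_mem' := fun _ _ => rfl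
  mul_mem' := fun {φ ψ} hφ hψ u v => (hφ (ψ u) (ψ v)).trans (hψ u v)
  inv_mem' := fun {φ} hφ u v => by
    have := hφ (φ⁻¹ u) (φ⁻¹ v)
    rw [← this]
    simp

/-- **B. H. Neumann's lemma**: a group acting transitively on an infinite set moves any finite set
off itself. -/
theorem exists_smul_notMem_of_isPretransitive (G : Type*) [Group G] [MulAction G V]
    [MulAction.IsPretransitive G V] [Infinite V] (F : Finset V) :
    ∃ g : G, ∀ a ∈ F, g • a ∉ F := by
  classical
  by_contra! h
  choose g hg using fun p : V × V => MulAction.exists_smul_eq G p.1 p.2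
  -- If every group element sends some `a ∈ F` to some `b ∈ F`, finitely many cosets of point
  -- stabilizers cover the group. One stabilizer then has finite index, against its orbit being
  -- infinite.
  have hcover : ⋃ p ∈ F ×ˢ F, g p • (MulAction.stabilizer G p.1 : Set G) = Set.univ := by
    refine Set.eq_univ_of_forall fun γ => ?_
    obtain ⟨a, ha, hb⟩ := h γ
    refine Set.mem_iUnion₂.2 ⟨(a, γ • a), Finset.mem_product.2 ⟨ha, hb⟩, ?_⟩
    rw [Set.mem_smul_set_iff_inv_smul_mem, SetLike.mem_coe, MulAction.mem_stabilizer_iff,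
      smul_eq_mul, mul_smul, inv_smul_eq_iff]
    exact (hg (a, γ • a)).symm
  obtain ⟨p, -, hp⟩ := Subgroup.exists_finiteIndex_of_leftCoset_cover hcover
  refine hp.index_ne_zero ?_
  rw [MulAction.index_stabilizer, MulAction.orbit_eq_univ, Set.ncard_univ,
    Nat.card_eq_zero_of_infinite]

theorem IsTransitive.exists_symmetry_notMem [Infinite V] {K : V → V → ℝ} (hK : IsTransitive K)
    (F : Finset V) : ∃ φ ∈ symmetries K, ∀ a ∈ F, φ a ∉ F := by
  have : MulAction.IsPretransitive (symmetries K) V := ⟨fun x y => by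
    obtain ⟨φ, hφ, h⟩ := hK x y
    exact ⟨⟨φ, h⟩, hφ⟩⟩
  obtain ⟨φ, hφ⟩ := exists_smul_notMem_of_isPretransitive (symmetries K) F
  exact ⟨φ, φ.2, hφ⟩

/-- The action of a permutation of the sites on the coordinates of configurations. -/
def permCoord (φ : Equiv.Perm V) : Equiv.Perm (V ⊕ V × ℕ) :=
  Equiv.sumCongr φ (Equiv.prodCongr φ (Equiv.refl ℕ))

/-- The action of a permutation of the sites on configurations. -/
def transport (φ : Equiv.Perm V) (ω : Config V) : Config V :=
  fun j => Prod.map id (fun t k => φ (t k)) (ω ((permCoord φ).symm j))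

theorem num_transport (φ : Equiv.Perm V) (ω : Config V) (x : V) :
    num (transport φ ω) (φ x) = num ω x := by
  simp [num, transport, permCoord]

theorem path_transport (φ : Equiv.Perm V) (ω : Config V) (x : V) (i j : ℕ) :
    path (transport φ ω) (φ x) i j = φ (path ω x i j) := by
  simp [path, transport, permCoord]

/-- The set of recurrent sites of a configuration. -/
def recSet (ω : Config V) : Set V := {v | IsRecurrent (num ω) (path ω) v}

theorem mem_recSet_transport {φ : Equiv.Perm V} {ω : Config V} {v : V} :
    φ v ∈ recSet (transport φ ω) ↔ v ∈ recSet ω := by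
  constructor
  · intro h
    have := IsRecurrent.perm (n' := num ω) (s' := path ω) φ.symm (fun x => ?_)
      (fun x i j => ?_) h
    · rwa [Equiv.symm_apply_apply] at this
    · rw [← num_transport φ, Equiv.apply_symm_apply]
    · rw [Equiv.eq_symm_apply, ← path_transport φ, Equiv.apply_symm_apply]
  · exact IsRecurrent.perm φ (num_transport φ ω) (path_transport φ ω)

variable [MeasurableSpace V] [Countable V] [DiscreteMeasurableSpace V]

theorem measurable_permPath (φ : Equiv.Perm V) :
    Measurable (Prod.map (id : ℕ → ℕ) fun (t : ℕ → V) k => φ (t k)) :=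
  measurable_id.prodMap (measurable_pi_iff.2 fun k =>
    (measurable_of_countable φ).comp (measurable_pi_apply k))

theorem measurable_transport (φ : Equiv.Perm V) : Measurable (transport φ) :=
  measurable_pi_iff.2 fun _ => (measurable_permPath φ).comp (measurable_pi_apply _)

theorem measurableSet_mem_recSet (v : V) : MeasurableSet {ω : Config V | v ∈ recSet ω} :=
  measurableSet_isRecurrent measurable_num measurable_path_apply v

namespace IsFrogLaw

variable {K : V → V → ℝ} {Q : V → Measure (ℕ → V)} {Λ : V ⊕ V × ℕ → Measure (ℕ × (ℕ → V))}

/-- Transport permutes the coordinates and maps each of them separately, so the image is again a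
product measure and only the marginals have to be compared. -/
theorem map_transport (L : IsFrogLaw K Q Λ) {φ : Equiv.Perm V} (hφ : φ ∈ symmetries K) :
    (Measure.infinitePi Λ).map (transport φ) = Measure.infinitePi Λ := by
  have := L.prob
  have h1 := Measure.map_infinitePi_infinitePi_of_inj (P := Λ) (permCoord φ).symm.injective
  have h2 := Measure.infinitePi_map_pi (μ := fun j => Λ ((permCoord φ).symm j))
    (f := fun _ => Prod.map (id : ℕ → ℕ) fun (t : ℕ → V) k => φ (t k))
    fun _ => measurable_permPath φ
  have hm : Measurable fun (ω : Config V) j =>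
      Prod.map (id : ℕ → ℕ) (fun (t : ℕ → V) k => φ (t k)) (ω j) :=
    measurable_pi_iff.2 fun j => (measurable_permPath φ).comp (measurable_pi_apply j)
  rw [← h1, Measure.map_map hm (by fun_prop)] at h2
  refine h2.trans ?_
  congr 1
  funext j
  rcases j with x | p
  · have := L.number (φ.symm x) φ
    rw [Equiv.apply_symm_apply] at this
    exact this.symm
  · have h := IsChainLaw.map_perm L.chain hφ (φ.symm p.1)
    rw [Equiv.apply_symm_apply] at h
    have hm' : Measurable fun (t : ℕ → V) k => φ (t k) := measurable_pi_iff.2 fun k =>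
      (measurable_of_countable φ).comp (measurable_pi_apply k)
    change (Λ (Sum.inr (φ.symm p.1, p.2))).map _ = _
    rw [L.frog, L.frog, h, Measure.map_map (measurable_permPath φ) (by fun_prop),
      Measure.map_map (by fun_prop) hm']
    rfl

theorem measurePreserving_transport (L : IsFrogLaw K Q Λ) {φ : Equiv.Perm V}
    (hφ : φ ∈ symmetries K) :
    MeasurePreserving (transport φ) (Measure.infinitePi Λ) (Measure.infinitePi Λ) :=
  ⟨measurable_transport φ, L.map_transport hφ⟩

/-- Events which depend on disjoint finite sets of coordinates are independent. -/
theorem cylinder_inter_transport (L : IsFrogLaw K Q Λ) {φ : Equiv.Perm V}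
    {s : Finset (V ⊕ V × ℕ)} (hs : ∀ j ∈ s, permCoord φ j ∉ s)
    {S : Set (∀ _ : s, ℕ × (ℕ → V))} (hS : MeasurableSet S) :
    Measure.infinitePi Λ (cylinder s S ∩ transport φ ⁻¹' cylinder s S) =
      Measure.infinitePi Λ (cylinder s S) *
        Measure.infinitePi Λ (transport φ ⁻¹' cylinder s S) := by
  have := L.prob
  set s' : Finset (V ⊕ V × ℕ) := s.map (permCoord φ).symm.toEmbedding with hs'
  have hdisj : Disjoint s s' := by
    refine Finset.disjoint_left.2 fun j hj hj' => ?_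
    obtain ⟨i, hi, rfl⟩ := Finset.mem_map.1 hj'
    refine hs _ hj ?_
    simpa using hi
  have hmem : ∀ i : s, (permCoord φ).symm i ∈ s' := fun i =>
    Finset.mem_map.2 ⟨i, i.2, rfl⟩
  have hind : iIndepFun (fun (j : V ⊕ V × ℕ) (ω : Config V) => ω j) (Measure.infinitePi Λ) :=
    iIndepFun_infinitePi (X := fun _ ω => ω) fun _ => measurable_id
  have h := hind.indepFun_finset s s' hdisj fun j => measurable_pi_apply j
  -- `g` expresses the transported cylinder through the coordinates in `s'`, which are disjoint from
  -- `s`.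
  set g : (∀ _ : s', ℕ × (ℕ → V)) → ∀ _ : s, ℕ × (ℕ → V) := fun r i =>
    Prod.map id (fun t k => φ (t k)) (r ⟨(permCoord φ).symm i, hmem i⟩) with hg
  have hgm : Measurable g := measurable_pi_iff.2 fun i =>
    (measurable_permPath φ).comp (measurable_pi_apply _)
  exact h.measure_inter_preimage_eq_mul S (g ⁻¹' S) hS (hgm hS)

/-- A cylinder `t` close to `I` is moved to an independent event `t'`, which by invariance is
equally close to `I`. Hence the measure of `I` equals its own square. -/
theorem measure_eq_zero_or_one_of_invariant [Infinite V] (L : IsFrogLaw K Q Λ)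
    (hK : IsTransitive K) {I : Set (Config V)} (hI : MeasurableSet I)
    (hinv : ∀ φ ∈ symmetries K, transport φ ⁻¹' I = I) :
    Measure.infinitePi Λ I = 0 ∨ Measure.infinitePi Λ I = 1 := by
  classical
  have := L.prob
  set μ := Measure.infinitePi Λ with hμ
  have hdense : μ.MeasureDense (measurableCylinders fun _ : V ⊕ V × ℕ => ℕ × (ℕ → V)) :=
    Measure.MeasureDense.of_generateFrom_isSetAlgebra_finite μ isSetAlgebra_measurableCylinders
      generateFrom_measurableCylinders.symm
  have hdiff : ∀ A B : Set (Config V), MeasurableSet A → MeasurableSet B →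
      |μ.real A - μ.real B| ≤ μ.real (symmDiff A B) := fun A B hA hB =>
    abs_measureReal_sub_le_measureReal_symmDiff hA.nullMeasurableSet
      hB.nullMeasurableSet
  -- Of the `4 * ε`, half is the error of `t ∩ t'` as an approximation of `I`, and each of the two
  -- factors `t`, `t'` costs a further `ε`.
  have key : ∀ ε : ℝ, 0 < ε → |μ.real I - μ.real I * μ.real I| ≤ 4 * ε := by
    intro ε hε
    obtain ⟨t, ht, htI⟩ := hdense.approx I hI (measure_ne_top μ I) ε hε
    have htm := hdense.measurable t ht
    obtain ⟨s, S, hS, rfl⟩ := (mem_measurableCylinders t).1 ht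
    obtain ⟨φ, hφ, hF⟩ := hK.exists_symmetry_notMem
      (s.image (Sum.elim id Prod.fst))
    have hs : ∀ j ∈ s, permCoord φ j ∉ s := by
      intro j hj hj'
      refine hF _ (Finset.mem_image_of_mem _ hj) ?_
      have := Finset.mem_image_of_mem (Sum.elim id Prod.fst) hj'
      rcases j with x | p
      · exact this
      · exact this
    set t : Set (Config V) := cylinder s S
    set t' := transport φ ⁻¹' t with ht'
    have ht'm : MeasurableSet t' := measurable_transport φ htm
    have hIt : μ.real (symmDiff I t) ≤ ε := by
      rw [Measure.real]
      exact ENNReal.toReal_le_of_le_ofReal hε.le htI.le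
    have hIt' : μ.real (symmDiff I t') ≤ ε := by
      have : symmDiff I t' = transport φ ⁻¹' symmDiff I t := by
        rw [Set.preimage_symmDiff, hinv φ hφ]
      rw [this, Measure.real, (L.measurePreserving_transport hφ).measure_preimage
        (hI.symmDiff htm).nullMeasurableSet]
      exact hIt
    have hprod : μ.real (t ∩ t') = μ.real t * μ.real t' := by
      rw [Measure.real, L.cylinder_inter_transport hs hS, ENNReal.toReal_mul]
      rfl
    have h1 := abs_le.1 ((hdiff I t hI htm).trans hIt)
    have h2 := abs_le.1 ((hdiff I t' hI ht'm).trans hIt')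
    have h3 : |μ.real I - μ.real (t ∩ t')| ≤ 2 * ε := by
      refine (hdiff I (t ∩ t') hI (htm.inter ht'm)).trans ?_
      refine (measureReal_mono (s₂ := symmDiff I t ∪ symmDiff I t') fun ω hω => ?_).trans ?_
      · simp only [Set.mem_symmDiff, Set.mem_union, Set.mem_inter_iff] at hω ⊢
        tauto
      · exact (measureReal_union_le _ _).trans (by linarith)
    rw [hprod] at h3
    have h3 := abs_le.1 h3
    have b1 : μ.real I ≤ 1 := measureReal_le_one
    have b2 : μ.real t' ≤ 1 := measureReal_le_one
    have b3 : 0 ≤ μ.real I := measureReal_nonneg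
    have b4 : 0 ≤ μ.real t' := measureReal_nonneg
    rw [abs_le]
    constructor <;> nlinarith
  have hzero : μ.real I - μ.real I * μ.real I = 0 := by
    refine abs_nonpos_iff.1 (le_of_forall_pos_le_add fun ε hε => ?_)
    have := key (ε / 4) (by positivity)
    linarith
  have hfac : μ.real I * (1 - μ.real I) = 0 := by linarith
  rcases mul_eq_zero.1 hfac with h | h
  · left
    exact (measureReal_eq_zero_iff).1 h
  · right
    have h1 : μ.real I = 1 := by linarith
    rw [← ENNReal.ofReal_toReal (measure_ne_top μ I)]
    rw [Measure.real] at h1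
    rw [h1, ENNReal.ofReal_one]

end IsFrogLaw

end Symmetry

/-! ### A chain hits the recurrent set; occupied sites are recurrent -/

section ZeroOne

variable {V : Type*} {K : V → V → ℝ}

/-- Jensen's inequality with its defect: expand `∑ K x y * (f y - f x) ^ 2`, use subharmonicity in
the mixed term, and keep only the summand at `z`. -/
theorem sq_add_le_tsum_of_le_tsum (hK : IsStochastic K) {f : V → ℝ} (hf0 : ∀ y, 0 ≤ f y)
    (hf1 : ∀ y, f y ≤ 1) (x z : V) (hf : f x ≤ ∑' y, K x y * f y) :
    f x ^ 2 + K x z * (f z - f x) ^ 2 ≤ ∑' y, K x y * f y ^ 2 := by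
  have hK1 := hK.row_sum x
  have hs1 : Summable fun y => K x y * f y :=
    hK1.summable.of_nonneg_of_le (fun y => mul_nonneg (hK.nonneg x y) (hf0 y))
      fun y => mul_le_of_le_one_right (hK.nonneg x y) (hf1 y)
  have hs2 : Summable fun y => K x y * f y ^ 2 :=
    hK1.summable.of_nonneg_of_le (fun y => mul_nonneg (hK.nonneg x y) (sq_nonneg _))
      fun y => mul_le_of_le_one_right (hK.nonneg x y) (pow_le_one₀ (hf0 y) (hf1 y))
  have hsum : HasSum (fun y => K x y * (f y - f x) ^ 2)
      (∑' y, K x y * f y ^ 2 - 2 * f x * ∑' y, K x y * f y + f x ^ 2 * 1) := by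
    have h := (hs2.hasSum.sub (hs1.hasSum.mul_left (2 * f x))).add (hK1.mul_left (f x ^ 2))
    have hfun : (fun y => K x y * (f y - f x) ^ 2) = fun y =>
        K x y * f y ^ 2 - 2 * f x * (K x y * f y) + f x ^ 2 * K x y := by
      funext y
      ring
    rwa [hfun]
  have hle : K x z * (f z - f x) ^ 2 ≤ _ :=
    le_hasSum hsum z fun y _ => mul_nonneg (hK.nonneg x y) (sq_nonneg _)
  nlinarith [mul_le_mul_of_nonneg_left hf (hf0 x)]

/-- Rerouting the last frog at a transient site `v` to a trajectory which hits a recurrent site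
makes `v` recurrent. -/
theorem mem_recSet_reroute {ω : Config V} {v : V} {k : ℕ} {t : ℕ → V}
    (hk : num ω v = k + 1) (hv : v ∉ recSet ω) (hgood : Spreading (num ω) (path ω))
    (hgood' : Spreading (num (reroute (v, k) ω t)) (path (reroute (v, k) ω t)))
    (ht0 : t 0 = v) (ht : ∃ j, t j ∈ recSet ω) : v ∈ recSet (reroute (v, k) ω t) := by
  classical
  obtain ⟨j, hj⟩ := ht
  -- With only `k` frogs at `v` the frog number `k` is absent, so this recurrence holds whatever
  -- path that frog is given.
  have h1 : IsRecurrent (Function.update (num ω) v k) (path ω) (t j) :=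
    IsRecurrent.of_eq_off hgood hv (fun x hx => Function.update_of_ne hx _ _) hj
  have h2 : IsRecurrent (num (reroute (v, k) ω t)) (path (reroute (v, k) ω t)) (t j) := by
    refine h1.mono (fun x => ?_) fun x i hi => ?_
    · rw [num_reroute]
      by_cases hx : x = v
      · subst hx
        simp [hk]
      · simp [hx]
    · rw [path_reroute_of_ne]
      intro h
      obtain ⟨rfl, rfl⟩ := Prod.mk.inj h
      simp at hi
  refine IsRecurrent.of_reaches hgood' ?_ h2
  cases j with
  | zero =>
    rw [ht0]
    exact Relation.ReflTransGen.refl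
  | succ j =>
    refine Relation.ReflTransGen.single ⟨k, by rw [num_reroute, hk]; exact Nat.lt_succ_self k, j, ?_⟩
    rw [path_reroute_self (v, k) ω t]

variable [MeasurableSpace V]

/-- The probability that a chain started at `x` avoids all the recurrent sites. -/
noncomputable def missProb (Q : V → Measure (ℕ → V)) (ω : Config V) (x : V) : ℝ :=
  (Q x).real {t | ∀ k, t k ∉ recSet ω}

theorem missProb_nonneg {Q : V → Measure (ℕ → V)} (ω : Config V) (x : V) :
    0 ≤ missProb Q ω x := measureReal_nonneg

theorem IsFrogLaw.missProb_le_one {Q : V → Measure (ℕ → V)}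
    {Λ : V ⊕ V × ℕ → Measure (ℕ × (ℕ → V))} (L : IsFrogLaw K Q Λ) (ω : Config V) (x : V) :
    missProb Q ω x ≤ 1 := by
  have := (L.chain x).prob
  exact measureReal_le_one

variable [Countable V] [DiscreteMeasurableSpace V]

theorem measurableSet_miss :
    MeasurableSet {q : Config V × (ℕ → V) | ∀ k, q.2 k ∉ recSet q.1} := by
  have : {q : Config V × (ℕ → V) | ∀ k, q.2 k ∉ recSet q.1} =
      ⋂ k, ⋂ v, ({q : Config V × (ℕ → V) | q.2 k = v}ᶜ ∪ (Prod.fst ⁻¹' {ω | v ∈ recSet ω})ᶜ) := by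
    ext q
    simp only [← Set.compl_inter, Set.mem_iInter, Set.mem_compl_iff, Set.mem_inter_iff,
      Set.mem_preimage, Set.mem_ofPred_eq, not_and, forall_eq']
  rw [this]
  refine MeasurableSet.iInter fun k => MeasurableSet.iInter fun v => ?_
  exact (measurableSet_eq_fun ((measurable_pi_apply k).comp measurable_snd)
    measurable_const).compl.union (measurable_fst (measurableSet_mem_recSet v)).compl

namespace IsFrogLaw

variable {Q : V → Measure (ℕ → V)} {Λ : V ⊕ V × ℕ → Measure (ℕ × (ℕ → V))}

theorem measurable_missProb (L : IsFrogLaw K Q Λ) (x : V) :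
    Measurable fun ω => missProb Q ω x := by
  have := (L.chain x).prob
  exact (measurable_measure_prodMk_left measurableSet_miss).ennreal_toReal

theorem missProb_transport (L : IsFrogLaw K Q Λ) {φ : Equiv.Perm V} (hφ : φ ∈ symmetries K)
    (ω : Config V) (x : V) : missProb Q (transport φ ω) (φ x) = missProb Q ω x := by
  have hm : Measurable fun (t : ℕ → V) k => φ (t k) := measurable_pi_iff.2 fun k =>
    (measurable_of_countable φ).comp (measurable_pi_apply k)
  have hset : MeasurableSet {t : ℕ → V | ∀ k, t k ∉ recSet (transport φ ω)} :=
    measurable_prodMk_left (x := transport φ ω) measurableSet_miss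
  rw [missProb, missProb, IsChainLaw.map_perm L.chain hφ, map_measureReal_apply hm hset]
  congr 1
  ext t
  simp only [Set.mem_preimage, Set.mem_ofPred_eq, mem_recSet_transport]

theorem missProb_le_tsum (L : IsFrogLaw K Q Λ) (hK : IsStochastic K) (ω : Config V) (x : V) :
    missProb Q ω x ≤ ∑' y, K x y * missProb Q ω y := by
  have h := IsChainLaw.avoid_le_tsum L.chain (recSet ω) x
  have hs : Summable fun y => K x y * missProb Q ω y :=
    (hK.row_sum x).summable.of_nonneg_of_le
      (fun y => mul_nonneg (hK.nonneg x y) (missProb_nonneg ω y))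
      fun y => mul_le_of_le_one_right (hK.nonneg x y) (L.missProb_le_one ω y)
  have heq : ∑' y, ENNReal.ofReal (K x y) * Q y {t | ∀ k, t k ∉ recSet ω} =
      ENNReal.ofReal (∑' y, K x y * missProb Q ω y) := by
    rw [ENNReal.ofReal_tsum_of_nonneg
      (fun y => mul_nonneg (hK.nonneg x y) (missProb_nonneg ω y)) hs]
    refine tsum_congr fun y => ?_
    have := (L.chain y).prob
    rw [ENNReal.ofReal_mul (hK.nonneg x y), missProb, ofReal_measureReal]
  rw [heq] at h
  exact ENNReal.toReal_le_of_le_ofReal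
    (tsum_nonneg fun y => mul_nonneg (hK.nonneg x y) (missProb_nonneg ω y)) h

/-- By stationarity, the subharmonic function `missProb` is almost surely constant along the
transitions of the chain. -/
theorem ae_missProb_eq (L : IsFrogLaw K Q Λ) (hK : IsStochastic K) (hKtrans : IsTransitive K)
    {x z : V} (hxz : 0 < K x z) :
    ∀ᵐ ω ∂Measure.infinitePi Λ, missProb Q ω z = missProb Q ω x := by
  have := L.isProbabilityMeasure
  set μ := Measure.infinitePi Λ
  have hsq : ∀ y, Measurable fun ω => ENNReal.ofReal (missProb Q ω y ^ 2) := fun y =>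
    ((L.measurable_missProb y).pow_const 2).ennreal_ofReal
  set b := ∫⁻ ω, ENNReal.ofReal (missProb Q ω x ^ 2) ∂μ with hb
  have hconst : ∀ y, ∫⁻ ω, ENNReal.ofReal (missProb Q ω y ^ 2) ∂μ = b := by
    intro y
    obtain ⟨φ, rfl, hφ⟩ := hKtrans x y
    rw [← (L.measurePreserving_transport hφ).lintegral_comp (hsq (φ x))]
    simp_rw [L.missProb_transport hφ]
    exact hb.symm
  have hbtop : b ≠ ⊤ := by
    refine ne_top_of_le_ne_top ENNReal.one_ne_top ?_
    calc b ≤ ∫⁻ _, 1 ∂μ := lintegral_mono fun ω => by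
          rw [← ENNReal.ofReal_one]
          exact ENNReal.ofReal_le_ofReal
            (pow_le_one₀ (missProb_nonneg ω x) (L.missProb_le_one ω x))
      _ = 1 := by simp
  have hd : Measurable fun ω => ENNReal.ofReal (K x z * (missProb Q ω z - missProb Q ω x) ^ 2) :=
    ((((L.measurable_missProb z).sub (L.measurable_missProb x)).pow_const 2).const_mul
      _).ennreal_ofReal
  have hpoint : ∀ ω, ENNReal.ofReal (missProb Q ω x ^ 2) +
      ENNReal.ofReal (K x z * (missProb Q ω z - missProb Q ω x) ^ 2) ≤
      ∑' y, ENNReal.ofReal (K x y) * ENNReal.ofReal (missProb Q ω y ^ 2) := by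
    intro ω
    have h := sq_add_le_tsum_of_le_tsum hK (missProb_nonneg ω) (L.missProb_le_one ω) x z
      (L.missProb_le_tsum hK ω x)
    have hs : Summable fun y => K x y * missProb Q ω y ^ 2 :=
      (hK.row_sum x).summable.of_nonneg_of_le
        (fun y => mul_nonneg (hK.nonneg x y) (sq_nonneg _)) fun y =>
          mul_le_of_le_one_right (hK.nonneg x y)
            (pow_le_one₀ (missProb_nonneg ω y) (L.missProb_le_one ω y))
    simp_rw [← ENNReal.ofReal_mul (hK.nonneg x _)]
    rw [← ENNReal.ofReal_tsum_of_nonneg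
      (fun y => mul_nonneg (hK.nonneg x y) (sq_nonneg _)) hs, ← ENNReal.ofReal_add (sq_nonneg _)
      (mul_nonneg (hK.nonneg x z) (sq_nonneg _))]
    exact ENNReal.ofReal_le_ofReal h
  -- Both second moments equal the finite number `b`, so integration leaves no room for the defect
  -- at `z`.
  have hint := lintegral_mono (μ := μ) hpoint
  rw [lintegral_add_left (hsq x),
    lintegral_tsum fun y => ((hsq y).const_mul _).aemeasurable] at hint
  simp_rw [lintegral_const_mul _ (hsq _), hconst] at hint
  rw [ENNReal.tsum_mul_right, ← ENNReal.ofReal_tsum_of_nonneg (hK.nonneg x) (hK.row_sum x).summable,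
    (hK.row_sum x).tsum_eq, ENNReal.ofReal_one, one_mul] at hint
  have hzero : ∫⁻ ω, ENNReal.ofReal (K x z * (missProb Q ω z - missProb Q ω x) ^ 2) ∂μ = 0 := by
    have : b + ∫⁻ ω, ENNReal.ofReal (K x z * (missProb Q ω z - missProb Q ω x) ^ 2) ∂μ ≤ b + 0 := by
      rwa [add_zero]
    exact le_antisymm ((ENNReal.add_le_add_iff_left hbtop).1 this) zero_le
  rw [lintegral_eq_zero_iff hd] at hzero
  filter_upwards [hzero] with ω hω
  have h1 : K x z * (missProb Q ω z - missProb Q ω x) ^ 2 ≤ 0 := ENNReal.ofReal_eq_zero.1 hω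
  have h2 : (missProb Q ω z - missProb Q ω x) ^ 2 ≤ 0 := by
    by_contra! h
    exact absurd h1 (not_le.2 (mul_pos hxz h))
  have h3 := pow_eq_zero_iff (two_ne_zero) |>.1 (le_antisymm h2 (sq_nonneg _))
  linarith

/-- Almost surely, if there is a recurrent site at all, then an independent chain hits some
recurrent site, wherever it starts. -/
theorem ae_missProb_eq_zero (L : IsFrogLaw K Q Λ) (hK : IsStochastic K)
    (hKtrans : IsTransitive K) (hKirr : IsIrreducible K) :
    ∀ᵐ ω ∂Measure.infinitePi Λ, (recSet ω).Nonempty → ∀ x, missProb Q ω x = 0 := by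
  have h : ∀ᵐ ω ∂Measure.infinitePi Λ, ∀ x z, 0 < K x z → missProb Q ω z = missProb Q ω x := by
    simp_rw [ae_all_iff]
    exact fun x z hxz => L.ae_missProb_eq hK hKtrans hxz
  filter_upwards [h] with ω hω
  rintro ⟨v, hv⟩ x
  have hconst : missProb Q ω v = missProb Q ω x := by
    have := hKirr x v
    clear hv
    induction this with
    | refl => rfl
    | @tail y z _ hyz ih => exact (hω y z hyz).trans ih
  rw [← hconst, missProb, measureReal_eq_zero_iff (by have := (L.chain v).prob; finiteness)]
  refine measure_eq_zero_iff_ae_notMem.2 ?_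
  filter_upwards [(L.chain v).start] with t ht0 ht
  exact ht 0 (ht0 ▸ hv)

theorem measure_transient_eq_zero (L : IsFrogLaw K Q Λ) (hK : IsStochastic K)
    (hKtrans : IsTransitive K) (hKirr : IsIrreducible K)
    (hne : ∀ᵐ ω ∂Measure.infinitePi Λ, (recSet ω).Nonempty) (v : V) (k : ℕ) :
    Measure.infinitePi Λ {ω | num ω v = k + 1 ∧ v ∉ recSet ω} = 0 := by
  have := L.isProbabilityMeasure
  have := (L.chain v).prob
  set μ := Measure.infinitePi Λ with hμ
  set A : Set (Config V) := {ω | num ω v = k + 1 ∧ v ∉ recSet ω} with hA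
  have hAm : MeasurableSet A := (measurableSet_eq_fun (measurable_num v) measurable_const).inter
    (measurableSet_mem_recSet v).compl
  -- `B`: resampling the last frog of `v` almost surely leads out of `A`. Since `B` ignores the old
  -- path of this frog, `A ∩ B` is null; and almost every point of `A` lies in `B`.
  set B : Set (Config V) := {ω | Q v (reroute (v, k) ω ⁻¹' A) = 0} with hB
  have hBm : MeasurableSet B := measurableSet_eq_fun
    (measurable_measure_prodMk_left (measurable_reroute (v, k) hAm)) measurable_const
  -- Rerouting preserves the law, so spreading also holds after it.
  have hgood' : ∀ᵐ ω ∂μ, ∀ᵐ t ∂Q v,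
      Spreading (num (reroute (v, k) ω t)) (path (reroute (v, k) ω t)) := by
    refine Measure.ae_ae_of_ae_prod (μ := μ) (ν := Q v)
      (p := fun q => Spreading (num (reroute (v, k) q.1 q.2)) (path (reroute (v, k) q.1 q.2))) ?_
    have := L.ae_spreading hKirr
    rw [← L.map_reroute (v, k)] at this
    exact ae_of_ae_map (measurable_reroute (v, k)).aemeasurable this
  have hAB : ∀ᵐ ω ∂μ, ω ∈ A → ω ∈ B := by
    filter_upwards [hne, L.ae_missProb_eq_zero hK hKtrans hKirr, L.ae_spreading hKirr, hgood']
      with ω hω hmiss hsp hsp' hωA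
    have hhit : ∀ᵐ t ∂Q v, ∃ j, t j ∈ recSet ω := by
      have h := hmiss hω v
      rw [missProb, measureReal_eq_zero_iff] at h
      filter_upwards [measure_eq_zero_iff_ae_notMem.1 h] with t ht
      simpa using ht
    refine measure_eq_zero_iff_ae_notMem.2 ?_
    filter_upwards [hhit, (L.chain v).start, hsp'] with t ht ht0 hspt htA
    exact htA.2 (mem_recSet_reroute hωA.1 hωA.2 hsp hspt ht0 ht)
  have hrr : ∀ ω t t', reroute (v, k) (reroute (v, k) ω t) t' = reroute (v, k) ω t' := by
    intro ω t t'
    simp [reroute]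
  have h0 : μ (A ∩ B) = 0 := by
    rw [hμ, L.apply_eq_lintegral_reroute (v, k) (hAm.inter hBm)]
    refine (lintegral_congr fun ω => ?_).trans lintegral_zero
    by_cases hω : ω ∈ B
    · exact measure_mono_null (fun t ht => ht.1) hω
    · convert measure_empty (μ := Q v)
      refine Set.eq_empty_iff_forall_notMem.2 fun t ht => hω ?_
      have h : Q v (reroute (v, k) (reroute (v, k) ω t) ⁻¹' A) = 0 := ht.2
      have heq : reroute (v, k) (reroute (v, k) ω t) = reroute (v, k) ω := funext (hrr ω t)
      rwa [heq] at h
  refine measure_mono_null (fun ω hω => ?_) (measure_union_null h0 hAB)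
  by_cases hωB : ω ∈ B
  · exact Or.inl ⟨hω, hωB⟩
  · exact Or.inr fun h => hωB (h hω)

/-- The zero-one law for configurations. -/
theorem ae_transient_or_ae_recurrent [Infinite V] (L : IsFrogLaw K Q Λ) (hK : IsStochastic K)
    (hKtrans : IsTransitive K) (hKirr : IsIrreducible K) :
    (∀ᵐ ω ∂Measure.infinitePi Λ, ∀ v, v ∉ recSet ω) ∨
      ∀ᵐ ω ∂Measure.infinitePi Λ, ∀ v, 1 ≤ num ω v → v ∈ recSet ω := by
  have := L.isProbabilityMeasure
  have hIm : MeasurableSet {ω : Config V | (recSet ω).Nonempty} := by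
    have : {ω : Config V | (recSet ω).Nonempty} = ⋃ v, {ω | v ∈ recSet ω} := by
      ext ω
      simp [Set.Nonempty]
    rw [this]
    exact MeasurableSet.iUnion measurableSet_mem_recSet
  have hinv : ∀ φ ∈ symmetries K,
      transport φ ⁻¹' {ω : Config V | (recSet ω).Nonempty} = {ω | (recSet ω).Nonempty} := by
    intro φ _
    ext ω
    constructor
    · rintro ⟨v, hv⟩
      refine ⟨φ.symm v, (mem_recSet_transport (φ := φ)).1 ?_⟩
      rwa [Equiv.apply_symm_apply]
    · rintro ⟨v, hv⟩
      exact ⟨φ v, mem_recSet_transport.2 hv⟩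
  rcases L.measure_eq_zero_or_one_of_invariant hKtrans hIm hinv with h | h
  · left
    filter_upwards [measure_eq_zero_iff_ae_notMem.1 h] with ω hω v hv
    exact hω ⟨v, hv⟩
  · right
    have hne : ∀ᵐ ω ∂Measure.infinitePi Λ, (recSet ω).Nonempty := (prob_compl_eq_zero_iff hIm).2 h
    have h0 : ∀ᵐ ω ∂Measure.infinitePi Λ, ∀ v k, ¬ (num ω v = k + 1 ∧ v ∉ recSet ω) := by
      simp_rw [ae_all_iff]
      exact fun v k => measure_eq_zero_iff_ae_notMem.1
        (L.measure_transient_eq_zero hK hKtrans hKirr hne v k)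
    filter_upwards [h0] with ω hω v hv
    by_contra hnot
    exact hω v (num ω v - 1) ⟨by omega, hnot⟩

end IsFrogLaw

end ZeroOne

/-! ### From the given random variables to the product law -/

section Transfer

variable {Ω V : Type*} [MeasurableSpace Ω] [MeasurableSpace V] {P : Measure Ω} {K : V → V → ℝ}

/-- The configuration formed by frog numbers and trajectories. -/
def toConfig (η : V → Ω → ℕ) (S : V → ℕ → ℕ → Ω → V) (ω : Ω) : Config V :=
  Sum.elim (fun x => (η x ω, fun _ => x)) fun p => (0, fun j => S p.1 p.2 j ω)

theorem measurable_toConfig_apply {η : V → Ω → ℕ} (hη : ∀ x, Measurable (η x))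
    {S : V → ℕ → ℕ → Ω → V} (hS : ∀ x i j, Measurable (S x i j)) (c : V ⊕ V × ℕ) :
    Measurable fun ω => toConfig η S ω c := by
  rcases c with x | p
  · exact (hη x).prodMk measurable_const
  · exact measurable_const.prodMk (measurable_pi_iff.2 fun j => hS p.1 p.2 j)

theorem IndependentIngredients.iIndepFun_toConfig {η : V → Ω → ℕ} {S : V → ℕ → ℕ → Ω → V}
    (hindep : IndependentIngredients P η S) :
    iIndepFun (fun c ω => toConfig η S ω c) P := by
  rw [iIndepFun_iff_iIndep]
  refine iIndep_of_iIndep_of_le hindep fun c => ?_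
  rcases c with x | p
  · have h : (fun ω => toConfig η S ω (Sum.inl x)) =
        (fun n : ℕ => (n, fun _ : ℕ => x)) ∘ η x := rfl
    rw [h, ← MeasurableSpace.comap_comp]
    exact MeasurableSpace.comap_mono (by fun_prop : Measurable fun n : ℕ =>
      (n, fun _ : ℕ => x)).comap_le
  · have h : (fun ω => toConfig η S ω (Sum.inr p)) =
        (fun t : ℕ → V => ((0 : ℕ), t)) ∘ fun ω j => S p.1 p.2 j ω := rfl
    rw [h, ← MeasurableSpace.comap_comp]
    exact MeasurableSpace.comap_mono (by fun_prop : Measurable fun t : ℕ → V =>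
      ((0 : ℕ), t)).comap_le

variable [Countable V] [DiscreteMeasurableSpace V] [IsProbabilityMeasure P]

theorem IsMarkovChain.isChainLaw {x : V} {Y : ℕ → Ω → V} (hY : IsMarkovChain P K x Y) :
    IsChainLaw K x (P.map fun ω j => Y j ω) := by
  have hm : Measurable fun ω j => Y j ω := measurable_pi_iff.2 hY.measurable
  refine ⟨Measure.isProbabilityMeasure_map hm.aemeasurable, ?_, fun m a ha => ?_⟩
  · rw [ae_map_iff hm.aemeasurable (measurableSet_eq_fun (measurable_pi_apply 0) measurable_const)]
    exact hY.start
  · rw [Measure.map_apply hm (measurableSet_pathCylinder m a)]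
    have hset : ∀ m, MeasurableSet {ω | ∀ k ≤ m, Y k ω = a k} := fun m =>
      hm (measurableSet_pathCylinder m a)
    change P {ω | ∀ k ≤ m, Y k ω = a k} = _
    induction m with
    | zero =>
      rw [Finset.range_zero, Finset.prod_empty, ← mem_ae_iff_prob_eq_one (hset 0)]
      filter_upwards [hY.start] with ω hω k hk
      rw [Nat.le_zero.1 hk, hω, ha]
    | succ m ih =>
      have hinter : {ω | ∀ k ≤ m + 1, Y k ω = a k} =
          {ω | ∀ k ≤ m, Y k ω = a k} ∩ {ω | Y (m + 1) ω = a (m + 1)} := by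
        ext ω
        simp only [Set.mem_inter_iff, Set.mem_ofPred_eq, Nat.le_succ_iff, or_imp, forall_and,
          forall_eq]
      rw [hinter, Finset.prod_range_succ, ← ih]
      -- Given a null past, `step` is silent, but then both sides vanish.
      by_cases h0 : P {ω | ∀ k ≤ m, Y k ω = a k} = 0
      · rw [h0, zero_mul]
        exact measure_mono_null Set.inter_subset_left h0
      · have := hY.step m a (a (m + 1)) h0
        rw [← this, ofReal_measureReal (by finiteness), mul_comm, cond_mul_eq_inter (hset m)]

/-- By uniqueness of the chain law all frogs from `x` have the same path law, so frog number `0` can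
represent it. -/
theorem isFrogLaw_map_toConfig {η : V → Ω → ℕ} (hη : ∀ x, Measurable (η x))
    (hηid : ∀ x y, IdentDistrib (η x) (η y) P P) {S : V → ℕ → ℕ → Ω → V}
    (hS : ∀ x i, IsMarkovChain P K x (S x i)) :
    IsFrogLaw K (fun x => P.map fun ω j => S x 0 j ω)
      fun c => P.map fun ω => toConfig η S ω c := by
  have hm := measurable_toConfig_apply hη fun x i j => (hS x i).measurable j
  have hmS : ∀ x i, Measurable fun ω j => S x i j ω := fun x i =>
    measurable_pi_iff.2 (hS x i).measurable
  refine ⟨fun c => Measure.isProbabilityMeasure_map (hm c).aemeasurable,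
    fun x => (hS x 0).isChainLaw, fun p => ?_, fun x φ => ?_⟩
  · rw [(hS p.1 0).isChainLaw.unique (hS p.1 p.2).isChainLaw,
      Measure.map_map (by fun_prop) (hmS p.1 p.2)]
    rfl
  · have h : ∀ y z : V, P.map (fun ω => (η y ω, fun _ : ℕ => z)) =
        (P.map (η x)).map fun n => (n, fun _ : ℕ => z) := by
      intro y z
      rw [← (hηid y x).map_eq, Measure.map_map (by fun_prop) (hη y)]
      rfl
    rw [Measure.map_map (measurable_permPath φ) (hm _)]
    exact (h (φ x) (φ x)).trans (h x (φ x)).symm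

end Transfer

end FrogModel

theorem theorem1 {Ω V : Type*} [MeasurableSpace Ω]
    [Countable V] [Infinite V] [MeasurableSpace V] [DiscreteMeasurableSpace V]
    (P : MeasureTheory.Measure Ω) [MeasureTheory.IsProbabilityMeasure P]
    (K : V → V → ℝ) (hK : FrogModel.IsStochastic K)
    (hKtrans : FrogModel.IsTransitive K) (hKirr : FrogModel.IsIrreducible K)
    (η : V → Ω → ℕ) (hη : ∀ x, Measurable (η x))
    (hηid : ∀ x y, ProbabilityTheory.IdentDistrib (η x) (η y) P P)
    (S : V → ℕ → ℕ → Ω → V) (hS : ∀ x i, FrogModel.IsMarkovChain P K x (S x i))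
    (hindep : FrogModel.IndependentIngredients P η S) :
    (∀ᵐ ω ∂P, ∀ v, FrogModel.IsTransient (fun x => η x ω) (fun x i j => S x i j ω) v) ∨
    (∀ᵐ ω ∂P, ∀ v, 1 ≤ η v ω →
      FrogModel.IsRecurrent (fun x => η x ω) (fun x i j => S x i j ω) v) := by
  have hm := FrogModel.measurable_toConfig_apply hη fun x i j => (hS x i).measurable j
  have hlaw := hindep.iIndepFun_toConfig.map_fun_eq_infinitePi_map hm
  have hm' : Measurable (FrogModel.toConfig η S) := measurable_pi_iff.2 hm
  have h := (FrogModel.isFrogLaw_map_toConfig hη hηid hS).ae_transient_or_ae_recurrent hK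
    hKtrans hKirr
  rw [← hlaw] at h
  -- The frog numbers and paths of `toConfig η S ω` are by definition the given ones, so both
  -- alternatives pull back to `P`.
  exact h.imp (MeasureTheory.ae_of_ae_map hm'.aemeasurable)
    (MeasureTheory.ae_of_ae_map hm'.aemeasurable)
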